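/- **Theorem (infrastructure distance formula).** Let $D>0$ be a non-square integer. A form $(a,b,c)$ means an integral binary quadratic form $ax^2+bxy+cy^2$ of discriminant $b^2-4ac=D$; write $\sim$ for proper (that is, $SL_2(\mathbb Z)$-) equivalence. The form is primitive if $\gcd(a,b,c)=1$ and reduced if $|\sqrt D-2|a||<b<\sqrt D$. *Distance.* To $F=(a,b,c)$ attach the number $x_F=\frac{b+\sqrt D}{2|a|}$. For a reduced form $F$ let $x_0=x_F$, $x_{i+1}=1/(x_i-\lfloor x_i\rfloor)$ be the complete quotients of its continued fraction. The $n$-th form $F_{(n)}$ of the cycle of $F$ is the form with $x_{F_{(n)}}=x_n$ whose leading coefficient has the sign of $(-1)^n a$ (so that consecutive forms are properly equivalent). For reduced $F\sim F'$ put $D(F,F')=\log(x_1x_2\cdots x_n)$ with $n\ge 0$ least such that $F'=F_{(n)}$. The regulator is $R=\log(x_1\cdots x_\pi)$, computed for the reduced principal form $P=(1,b,c)$ (where $b$ is the largest integer below $\sqrt D$ with $b\equiv D \pmod 2$), with $\pi>0$ least such that $P_{(\pi)}=P$: the distance around the principal cycle. *Composition.* For $F=(a_1,b_1,c_1)$ and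 $G=(a_2,b_2,c_2)$ let $m=\gcd(a_1,a_2,\frac{b_1+b_2}2)$, the factor cancelled in the composition, and $$F*G=\Bigl(\frac{a_1a_2}{m^2},\,B,\,\frac{(B^2-D)m^2}{4a_1a_2}\Bigr),$$ where $B$ is a solution of smallest absolute value of the congruences $a_2mB\equiv mb_1a_2$, $a_1mB\equiv mb_2a_1$, $\frac{b_1+b_2}2mB\equiv m\frac{b_1b_2+D}2 \pmod{2a_1a_2}$ (if $B$ and $-B$ both qualify, either may be chosen). *Reduction.* Given a form, (1) replace it by the form $(a,b',c')$ with $b'=b+2ak$, $k\in\mathbb Z$, of discriminant $D$, where $-|a|<b'\le|a|$ if $|a|>\sqrt D$ and $\sqrt D-2|a|<b'<\sqrt D$ if $|a|<\sqrt D$; (2) if $(a,b',c')$ is reduced, return it; otherwise replace it by $(c',-b',a)$ and go to (1). Let $\theta$ be the product of the numbers $\bigl|\frac{b'+\sqrt D}{2a}\bigr|$ over all forms $(a,b',c')$ that are swapped in step (2). If $K$ is the input and $H$ the output, then $\mathbb Z+\mathbb Z x_K=\theta(\mathbb Z+\mathbb Z x_H)$; the reduction distance of $K$ is $D_\rho=-\log\theta$.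 Write $F\#G$ for the reduction of $F*G$. Let $F_1\sim F_k$ and $G_1\sim G_\ell$ be reduced primitive forms of discriminant $D$. Let $D_{\rho,1}$ and $D_{\rho,2}$ be the reduction distances of $F_1*G_1$ and $F_k*G_\ell$, and let $m_1$ and $m_2$ be the factors cancelled in these two compositions. Then $F_1\#G_1\sim F_k\#G_\ell$ and $$D(F_1\#G_1,F_k\#G_\ell)\equiv D(F_1,F_k)+D(G_1,G_\ell)+D_{\rho,2}-D_{\rho,1}+\log(m_2/m_1)\pmod R,$$ that is, the two sides differ by an integer multiple of $R$. -/

import Mathlib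

/-- The integral binary quadratic form `a x² + b x y + c y²`. -/
@[ext]
structure BQForm where
  a : ℤ
  b : ℤ
  c : ℤ

namespace BQForm

/-- The value `f(x, y)`. -/
def eval (f : BQForm) (x y : ℤ) : ℤ := f.a * x ^ 2 + f.b * x * y + f.c * y ^ 2

/-- The discriminant `b² - 4ac`. -/
def disc (f : BQForm) : ℤ := f.b ^ 2 - 4 * f.a * f.c

/-- `gcd(a, b, c) = 1`. -/
def IsPrimitive (f : BQForm) : Prop := Int.gcd f.a (Int.gcd f.b f.c) = 1

/-- Proper equivalence: `g(x, y) = f(s x + t y, u x + v y)` for a matrix `[s, t; u, v]` in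
`SL₂(ℤ)`. -/
def ProperlyEquiv (f g : BQForm) : Prop :=
  ∃ s t u v : ℤ, s * v - t * u = 1 ∧
    ∀ x y : ℤ, g.eval x y = f.eval (s * x + t * y) (u * x + v * y)

/-- Reduced forms: `|√D - 2|a|| < b < √D`, where `D` is the discriminant. -/
def IsReduced (f : BQForm) : Prop :=
  abs (√(f.disc : ℝ) - 2 * abs (f.a : ℝ)) < (f.b : ℝ) ∧ (f.b : ℝ) < √(f.disc : ℝ)

/-- The real number `(b + √D) / (2|a|)` attached to a form. With `Q = 2|a|` and `P = b` it is
`x = (P + √D) / Q`, and the two forms of discriminant `D` attached to this `x` are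
`(± Q/2, P, ± (P² - D)/(2Q))`. -/
noncomputable def root (f : BQForm) : ℝ := ((f.b : ℝ) + √(f.disc : ℝ)) / (2 * |(f.a : ℝ)|)

/-! ### Continued fractions, distance, regulator -/

/-- The complete quotients of `α`: `x₀ = α` and `x_{i+1} = 1 / (x_i - ⌊x_i⌋)`. -/
noncomputable def completeQuotient (α : ℝ) : ℕ → ℝ
  | 0 => α
  | i + 1 => 1 / (completeQuotient α i - ⌊completeQuotient α i⌋)

/-- `g` is the `n`-th form of the cycle of `f`: it is attached to the complete quotient `x_n` of
the number `x₀` attached to `f`. The sign of the leading coefficient changes at each step, which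
makes consecutive forms properly equivalent. -/
def IsTerm (f g : BQForm) (n : ℕ) : Prop :=
  g.root = completeQuotient f.root n ∧ Int.sign g.a = (-1) ^ n * Int.sign f.a

/-- `log (x₁ x₂ ⋯ x_n)`, the distance from `f` to the `n`-th form of its cycle. -/
noncomputable def cycleLog (f : BQForm) (n : ℕ) : ℝ :=
  Real.log (∏ k ∈ Finset.Icc 1 n, completeQuotient f.root k)

/-- The infrastructure distance `D(f, g)`: the distance from `f` to the first occurrence of `g` in
the cycle of `f`. -/
noncomputable def dist (f g : BQForm) : ℝ := cycleLog f (sInf {n : ℕ | IsTerm f g n})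

/-- The period of the cycle of `f`. -/
noncomputable def period (f : BQForm) : ℕ := sInf {n : ℕ | 0 < n ∧ IsTerm f f n}

/-- The reduced form `(1, b, (b² - D)/4)`, where `b` is the largest integer with `b ≤ √D` and
`b ≡ D (mod 2)`. It starts the principal cycle. -/
noncomputable def principal (D : ℤ) : BQForm :=
  let r : ℤ := ⌊√(D : ℝ)⌋
  let b : ℤ := if Even (r - D) then r else r - 1
  ⟨1, b, (b ^ 2 - D) / 4⟩

/-- The regulator: the distance around the principal cycle. -/
noncomputable def regulator (D : ℤ) : ℝ := cycleLog (principal D) (period (principal D))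

/-! ### Composition -/

/-- The factor `m = gcd(a₁, a₂, (b₁ + b₂)/2)` cancelled in the composition of `f` and `g`. -/
def compFactor (f g : BQForm) : ℕ := Int.gcd f.a (Int.gcd g.a ((f.b + g.b) / 2))

/-- The three simultaneous congruences for the middle coefficient `B` of the composition. -/
def CompCongr (f g : BQForm) (B : ℤ) : Prop :=
  g.a * compFactor f g * B ≡ compFactor f g * f.b * g.a [ZMOD 2 * f.a * g.a] ∧
  f.a * compFactor f g * B ≡ compFactor f g * g.b * f.a [ZMOD 2 * f.a * g.a] ∧
  (f.b + g.b) / 2 * compFactor f g * B ≡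
    compFactor f g * ((f.b * g.b + f.disc) / 2) [ZMOD 2 * f.a * g.a]

/-- `h` is an output `f * g` of the composition algorithm for two forms of equal discriminant `D`:
`h = (a₁ a₂ / m², B, (B² - D) m² / (4 a₁ a₂))`, where `B` is a solution of smallest absolute value
of the congruences. (When `B` and `-B` are both such solutions, either may be output.) -/
def IsComposition (f g h : BQForm) : Prop :=
  h.a * (compFactor f g : ℤ) ^ 2 = f.a * g.a ∧
  h.disc = f.disc ∧
  CompCongr f g h.b ∧ ∀ B : ℤ, CompCongr f g B → |h.b| ≤ |B|

/-! ### Reduction -/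

/-- The translation `T_m : (a, b, c) ↦ (a, b + 2am, am² + bm + c)`. -/
def translate (m : ℤ) (f : BQForm) : BQForm :=
  ⟨f.a, f.b + 2 * f.a * m, f.a * m ^ 2 + f.b * m + f.c⟩

/-- The map `W : (a, b, c) ↦ (c, -b, a)`. -/
def swap (f : BQForm) : BQForm := ⟨f.c, -f.b, f.a⟩

/-- The middle coefficient lies in the normalization interval: `-|a| < b ≤ |a|` if `|a| ≥ √D`, and
`√D - 2|a| < b < √D` if `|a| < √D`. -/
def IsNormal (f : BQForm) : Prop :=
  (√(f.disc : ℝ) ≤ |(f.a : ℝ)| ∧ -|f.a| < f.b ∧ f.b ≤ |f.a|) ∨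
  (|(f.a : ℝ)| < √(f.disc : ℝ) ∧
    √(f.disc : ℝ) - 2 * |(f.a : ℝ)| < (f.b : ℝ) ∧ (f.b : ℝ) < √(f.disc : ℝ))

/-- `Reduces f h θ`: the reduction algorithm, started at `f`, stops at the reduced form `h`, and
`θ` is the number accumulated on the way with `ℒ_f = θ ℒ_h`, where `ℒ_f = ℤ + ℤ (b + √D)/(2|a|)`
is the lattice of `f` (see `Reduces.lattice`). A step normalizes the form by some `T_m`; if the
result `f'` is reduced it is returned, otherwise one continues with `W f'`, and
`ℒ_{f'} = |x'| ℒ_{W f'}` for the number `x'` attached to `f'`. -/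
inductive Reduces : BQForm → BQForm → ℝ → Prop
  | done (f : BQForm) (m : ℤ) (hn : (translate m f).IsNormal) (hr : (translate m f).IsReduced) :
      Reduces f (translate m f) 1
  | step (f h : BQForm) (m : ℤ) (θ : ℝ) (hn : (translate m f).IsNormal)
      (hr : ¬ (translate m f).IsReduced) (hs : Reduces (swap (translate m f)) h θ) :
      Reduces f h (|(translate m f).root| * θ)

/-- `IsCompRed f g h δ`: the form `h` is an output `f # g` of composition followed by reduction,
with reduction distance `δ = -log θ` from `f * g` to `h`. -/
def IsCompRed (f g h : BQForm) (δ : ℝ) : Prop :=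
  ∃ (k : BQForm) (θ : ℝ), IsComposition f g k ∧ Reduces k h θ ∧ δ = -Real.log θ

/-! ### The factor accumulated in the reduction relates the lattices -/

/-- The lattice `ℤ + ℤ (b + √D)/(2|a|)` of a form. -/
noncomputable def lattice (f : BQForm) : AddSubgroup ℝ := AddSubgroup.closure {1, f.root}

theorem disc_translate (m : ℤ) (f : BQForm) : (translate m f).disc = f.disc := by
  simp only [disc, translate]; ring

theorem disc_swap (f : BQForm) : (swap f).disc = f.disc := by
  simp only [disc, swap]; ring

theorem mem_lattice (f : BQForm) (r : ℝ) :
    r ∈ f.lattice ↔ ∃ u v : ℤ, r = u + v * f.root := by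
  simp only [lattice, AddSubgroup.mem_closure_pair, zsmul_eq_mul, mul_one, eq_comm]

theorem a_ne_zero {f : BQForm} (h : ¬ IsSquare f.disc) : f.a ≠ 0 := by
  intro h0
  exact h ⟨f.b, by simp only [disc, h0]; ring⟩

theorem root_translate (m : ℤ) {f : BQForm} (h : ¬ IsSquare f.disc) :
    ∃ k : ℤ, (translate m f).root = f.root + k := by
  have ha : (f.a : ℝ) ≠ 0 := by exact_mod_cast a_ne_zero h
  refine ⟨Int.sign f.a * m, ?_⟩
  have hs : (f.a : ℝ) = (Int.sign f.a : ℤ) * |(f.a : ℝ)| := by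
    exact_mod_cast (Int.sign_mul_abs f.a).symm
  have hb : |(f.a : ℝ)| ≠ 0 := abs_ne_zero.mpr ha
  simp only [root, disc_translate]
  simp only [translate]
  push_cast
  field_simp
  linear_combination (2 * (m : ℝ)) * hs

theorem root_swap {f : BQForm} (hD : 0 < f.disc) (h : ¬ IsSquare f.disc) :
    f.root ≠ 0 ∧ (f.root * (swap f).root = 1 ∨ f.root * (swap f).root = -1) := by
  have ha : (f.a : ℝ) ≠ 0 := by exact_mod_cast a_ne_zero h
  have hc : (f.c : ℝ) ≠ 0 := by
    have := a_ne_zero (f := swap f) (by rwa [disc_swap])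
    exact_mod_cast this
  have hb : |(f.a : ℝ)| ≠ 0 := abs_ne_zero.mpr ha
  have hd : |(f.c : ℝ)| ≠ 0 := abs_ne_zero.mpr hc
  have hsq : √(f.disc : ℝ) ^ 2 = f.b ^ 2 - 4 * f.a * f.c := by
    rw [Real.sq_sqrt (by exact_mod_cast hD.le)]; simp only [disc]; push_cast; ring
  have key : f.root * (swap f).root = -(f.a * f.c) / (|(f.a : ℝ)| * |(f.c : ℝ)|) := by
    simp only [root, disc_swap]
    simp only [swap]
    push_cast
    field_simp
    linear_combination hsq
  have hor : f.root * (swap f).root = 1 ∨ f.root * (swap f).root = -1 := by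
    rw [key, ← abs_mul]
    have hac : (f.a : ℝ) * f.c ≠ 0 := mul_ne_zero ha hc
    rcases abs_choice ((f.a : ℝ) * f.c) with h1 | h1 <;> rw [h1]
    · right; field_simp
    · left; field_simp
  refine ⟨?_, hor⟩
  intro h0
  rw [h0, zero_mul] at hor
  rcases hor with h1 | h1 <;> norm_num at h1

/-- The accumulated factor `θ` is positive and satisfies `ℒ_f = θ ℒ_h`. -/
theorem Reduces.lattice {f h : BQForm} {θ : ℝ} (hr : Reduces f h θ) (hD : 0 < f.disc)
    (hsq : ¬ IsSquare f.disc) :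
    0 < θ ∧ ∀ r : ℝ, r ∈ f.lattice ↔ ∃ s ∈ h.lattice, r = θ * s := by
  have trans_mem : ∀ (m : ℤ) (f : BQForm), ¬ IsSquare f.disc →
      ∀ r : ℝ, r ∈ f.lattice ↔ r ∈ (translate m f).lattice := by
    intro m f hsq r
    obtain ⟨k, hk⟩ := root_translate m hsq
    simp only [mem_lattice, hk]
    constructor
    · rintro ⟨u, v, rfl⟩; exact ⟨u - v * k, v, by push_cast; ring⟩
    · rintro ⟨u, v, rfl⟩; exact ⟨u + v * k, v, by push_cast; ring⟩
  have swap_mem : ∀ f : BQForm, 0 < f.disc → ¬ IsSquare f.disc →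
      0 < |f.root| ∧ ∀ r : ℝ, r ∈ f.lattice ↔ ∃ s ∈ (swap f).lattice, r = |f.root| * s := by
    intro f hD hsq
    obtain ⟨h0, h1⟩ := root_swap hD hsq
    refine ⟨abs_pos.mpr h0, fun r => ?_⟩
    obtain ⟨e, he, he'⟩ : ∃ e : ℤ, |f.root| * (swap f).root = e ∧ e * e = 1 := by
      rcases abs_choice f.root with h2 | h2 <;> rw [h2] <;> rcases h1 with h1 | h1
      · exact ⟨1, by rw [h1]; norm_num, by norm_num⟩
      · exact ⟨-1, by rw [h1]; norm_num, by norm_num⟩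
      · exact ⟨-1, by rw [neg_mul, h1]; norm_num, by norm_num⟩
      · exact ⟨1, by rw [neg_mul, h1]; norm_num, by norm_num⟩
    obtain ⟨d, hd, hd'⟩ : ∃ d : ℤ, |f.root| = d * f.root ∧ d * d = 1 := by
      rcases abs_choice f.root with h2 | h2
      · exact ⟨1, by rw [h2]; norm_num, by norm_num⟩
      · exact ⟨-1, by rw [h2]; norm_num, by norm_num⟩
    have heR : (e : ℝ) * e = 1 := by exact_mod_cast he'
    have hdR : (d : ℝ) * d = 1 := by exact_mod_cast hd'
    simp only [mem_lattice]
    constructor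
    · rintro ⟨u, v, rfl⟩
      refine ⟨_, ⟨d * v, e * u, rfl⟩, ?_⟩
      push_cast
      linear_combination (-(e : ℝ) * u) * he - (u : ℝ) * heR - ((d : ℝ) * v) * hd
        - ((v : ℝ) * f.root) * hdR
    · rintro ⟨s, ⟨u, v, rfl⟩, rfl⟩
      refine ⟨e * v, d * u, ?_⟩
      push_cast
      linear_combination (v : ℝ) * he + (u : ℝ) * hd
  induction hr with
  | done f m hn hr =>
    exact ⟨one_pos, fun r => by simp [trans_mem m f hsq r]⟩
  | step f h m θ hn hr hs ih =>
    have hD' : 0 < (translate m f).disc := by rwa [disc_translate]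
    have hsq' : ¬ IsSquare (translate m f).disc := by rwa [disc_translate]
    obtain ⟨hpos, hiff⟩ := swap_mem _ hD' hsq'
    obtain ⟨hθ, ih⟩ := ih (by rwa [disc_swap]) (by rwa [disc_swap])
    refine ⟨mul_pos hpos hθ, fun r => ?_⟩
    rw [trans_mem m f hsq, hiff]
    constructor
    · rintro ⟨s, hs, rfl⟩
      obtain ⟨t, ht, rfl⟩ := (ih s).mp hs
      exact ⟨t, ht, by ring⟩
    · rintro ⟨t, ht, rfl⟩
      exact ⟨θ * t, (ih _).mpr ⟨t, ht, rfl⟩, by ring⟩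

end BQForm

/-! Every operation in the theorem multiplies a lattice by a known number. Attach to a form the
lattice ℤ + ℤτ, τ = (b + √D)/(2a), embedded in ℝ × ℝ by the two real embeddings of ℚ(√D), so that
lattices can be multiplied as ℤ-submodules. Proper equivalence is then similarity by some l with l.1
> 0. The forms (a, b, c) and (-a, b, -c) share a lattice, so the sign of l.2 must also be recorded;
this is `IdealRel`.

A step along the cycle contributes the fractional part of the root, reduction contributes θ, and
composition contributes 1/m because the lattices of F and G multiply to 1/m times that of F * G
(`fracIdeal_mul`). Hence exp(-D(F, F')) is the first coordinate of a similarity from F to F'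
(`IdealRel.idealRel_dist`). Multiplying the similarities F₁ → Fₖ and G₁ → Gₗ gives a similarity H₁ →
H₂ between the two outputs whose negative logarithm is the right side of the formula without the
multiple of R. The distance D(H₁, H₂) gives another one. Their quotient r maps the product of the
lattices of F₁ and G₁ onto itself. Lattices of primitive forms are invertible, so r also fixes the
principal lattice (`idealRel_principal`), and then log r is a multiple of R
(`IdealRel.log_eq_regulator`).

The geometric core is the theory of relative minima: 1 is a minimum of the lattice of a reduced
form, the fractional part of the root gives the next one, and nothing lies between. So a similarity
between reduced forms with factor at most 1 is a walk along the cycle (`IdealRel.exists_iterate`).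
-/

namespace BQForm

open Submodule

/-! ### Lattices in the two real embeddings -/

/-- The rank one module generated by `l`. -/
noncomputable def scalar (l : ℝ × ℝ) : Submodule ℤ (ℝ × ℝ) := span ℤ {l}

theorem scalar_one : scalar 1 = 1 := Submodule.one_eq_span.symm

theorem scalar_mul (k l : ℝ × ℝ) : scalar (k * l) = scalar k * scalar l := by
  simp only [scalar, span_mul_span, Set.singleton_mul_singleton]

theorem scalar_inv_mul {l : ℝ × ℝ} (h₁ : l.1 ≠ 0) (h₂ : l.2 ≠ 0) :
    scalar l⁻¹ * scalar l = 1 := by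
  rw [← scalar_mul, ← scalar_one]
  congr 1
  ext <;> simp [h₁, h₂]

theorem mem_scalar_mul {l z : ℝ × ℝ} {S : Submodule ℤ (ℝ × ℝ)} :
    z ∈ scalar l * S ↔ ∃ w ∈ S, l * w = z :=
  mem_span_singleton_mul

/-- The images of `(b + √D) / (2a)` under the two real embeddings of `ℚ(√D)`. -/
noncomputable def tau (f : BQForm) : ℝ × ℝ :=
  (((f.b : ℝ) + √(f.disc : ℝ)) / (2 * (f.a : ℝ)), ((f.b : ℝ) - √(f.disc : ℝ)) / (2 * (f.a : ℝ)))

/-- The lattice `ℤ + ℤ (b + √D) / (2a)` in the two real embeddings. -/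
noncomputable def fracIdeal (f : BQForm) : Submodule ℤ (ℝ × ℝ) := span ℤ {1, tau f}

theorem mem_fracIdeal {f : BQForm} {z : ℝ × ℝ} :
    z ∈ fracIdeal f ↔
      ∃ u v : ℤ, z.1 = u + v * (tau f).1 ∧ z.2 = u + v * (tau f).2 := by
  simp only [fracIdeal, mem_span_pair, Prod.ext_iff, zsmul_eq_mul, Prod.fst_add, Prod.snd_add,
    Prod.fst_mul, Prod.snd_mul, mul_one, Prod.fst_intCast,
    Prod.snd_intCast, eq_comm]

/-- The conjugate `(b - √D) / (2|a|)` of `root`. -/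
noncomputable def conjRoot (f : BQForm) : ℝ := ((f.b : ℝ) - √(f.disc : ℝ)) / (2 * |(f.a : ℝ)|)

theorem exists_sign_mul_abs (a : ℤ) (ha : a ≠ 0) :
    ∃ e : ℤ, e * e = 1 ∧ (|(a : ℝ)|) = e * a ∧ a.sign = e := by
  rcases lt_or_gt_of_ne ha with h | h
  · refine ⟨-1, by norm_num, ?_, by rw [Int.sign_eq_neg_one_of_neg h]⟩
    rw [abs_of_neg (by exact_mod_cast h)]; push_cast; ring
  · refine ⟨1, by norm_num, ?_, by rw [Int.sign_eq_one_of_pos h]⟩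
    rw [abs_of_pos (by exact_mod_cast h)]; push_cast; ring

theorem exists_sign_mul_tau {f : BQForm} (ha : f.a ≠ 0) :
    ∃ e : ℤ, e * e = 1 ∧ f.root = e * (tau f).1 ∧ f.conjRoot = e * (tau f).2 ∧
      |(f.a : ℝ)| = e * f.a ∧ f.a.sign = e := by
  obtain ⟨e, he, hea, hs⟩ := exists_sign_mul_abs f.a ha
  have ha' : (f.a : ℝ) ≠ 0 := by exact_mod_cast ha
  have heR : (e : ℝ) * e = 1 := by exact_mod_cast he
  have he0 : (e : ℝ) ≠ 0 := left_ne_zero_of_mul_eq_one heR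
  refine ⟨e, he, ?_, ?_, hea, hs⟩
  · simp only [root, tau, hea]
    field_simp
    linear_combination (-((f.b : ℝ) + √(f.disc : ℝ))) * heR
  · simp only [conjRoot, tau, hea]
    field_simp
    linear_combination (-((f.b : ℝ) - √(f.disc : ℝ))) * heR

theorem mem_fracIdeal_iff_root {f : BQForm} (ha : f.a ≠ 0) {z : ℝ × ℝ} :
    z ∈ fracIdeal f ↔
      ∃ u v : ℤ, z.1 = u + v * f.root ∧ z.2 = u + v * f.conjRoot := by
  obtain ⟨e, he, h1, h2, -, -⟩ := exists_sign_mul_tau ha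
  have heR : (e : ℝ) * e = 1 := by exact_mod_cast he
  rw [mem_fracIdeal]
  constructor
  · rintro ⟨u, v, hz1, hz2⟩
    refine ⟨u, v * e, ?_, ?_⟩ <;> push_cast
    · rw [hz1, h1]; linear_combination (-(v : ℝ) * (tau f).1) * heR
    · rw [hz2, h2]; linear_combination (-(v : ℝ) * (tau f).2) * heR
  · rintro ⟨u, v, hz1, hz2⟩
    refine ⟨u, v * e, ?_, ?_⟩ <;> push_cast
    · rw [hz1, h1]; ring
    · rw [hz2, h2]; ring

theorem sq_sqrt_disc {f : BQForm} (hD : 0 < f.disc) :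
    √(f.disc : ℝ) ^ 2 = f.b ^ 2 - 4 * f.a * f.c := by
  rw [Real.sq_sqrt (by exact_mod_cast hD.le)]; simp only [disc]; push_cast; ring

/-- The lattices of `f` and `g` differ by the factor `l`, which is positive in the first embedding
and whose norm has the sign of the product of the leading coefficients. -/
structure IdealRel (f g : BQForm) (l : ℝ × ℝ) : Prop where
  eq : fracIdeal f = scalar l * fracIdeal g
  fst_pos : 0 < l.1
  sign : 0 < l.2 * (f.a * g.a)

namespace IdealRel

variable {f g h : BQForm} {k l : ℝ × ℝ}

theorem snd_ne_zero (H : IdealRel f g l) : l.2 ≠ 0 :=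
  left_ne_zero_of_mul H.sign.ne'

theorem refl (ha : f.a ≠ 0) : IdealRel f f 1 := by
  refine ⟨by rw [scalar_one, one_mul], one_pos, ?_⟩
  have : (f.a : ℝ) ≠ 0 := by exact_mod_cast ha
  simp only [Prod.snd_one, one_mul]
  exact mul_self_pos.mpr this

theorem symm (H : IdealRel f g l) : IdealRel g f l⁻¹ := by
  refine ⟨?_, ?_, ?_⟩
  · rw [H.eq, ← mul_assoc, scalar_inv_mul H.fst_pos.ne' H.snd_ne_zero, one_mul]
  · exact inv_pos.mpr H.fst_pos
  · have h1 := H.sign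
    have h2 := H.snd_ne_zero
    have : l⁻¹.2 * (g.a * f.a) = l.2 * (f.a * g.a) * (l.2⁻¹) ^ 2 := by
      simp only [Prod.snd_inv]; field_simp
    rw [this]
    exact mul_pos h1 (by positivity)

theorem trans (H : IdealRel f g l) (K : IdealRel g h k) : IdealRel f h (l * k) := by
  refine ⟨?_, mul_pos H.fst_pos K.fst_pos, ?_⟩
  · rw [H.eq, K.eq, scalar_mul, mul_assoc]
  · have h1 := mul_pos H.sign K.sign
    have h2 : 0 < (g.a : ℝ) ^ 2 := by
      have : (g.a : ℝ) ≠ 0 := by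
        intro h; have := H.sign; simp [h] at this
      positivity
    refine pos_of_mul_pos_left (b := (g.a : ℝ) ^ 2) ?_ h2.le
    calc 0 < _ := h1
      _ = _ := by simp only [Prod.snd_mul]; ring

end IdealRel

theorem idealRel_translate (m : ℤ) {f : BQForm} (ha : f.a ≠ 0) :
    IdealRel f (translate m f) 1 := by
  have ha' : (f.a : ℝ) ≠ 0 := by exact_mod_cast ha
  refine ⟨?_, one_pos, (IdealRel.refl ha).sign⟩
  rw [scalar_one, one_mul]
  have h1 : (tau (translate m f)).1 = (tau f).1 + m := by
    simp only [tau, disc_translate]; simp only [translate]; push_cast; field_simp; ring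
  have h2 : (tau (translate m f)).2 = (tau f).2 + m := by
    simp only [tau, disc_translate]; simp only [translate]; push_cast; field_simp; ring
  ext z
  simp only [mem_fracIdeal, h1, h2]
  constructor
  · rintro ⟨u, v, hu, hv⟩
    exact ⟨u - v * m, v, by rw [hu]; push_cast; ring, by rw [hv]; push_cast; ring⟩
  · rintro ⟨u, v, hu, hv⟩
    exact ⟨u + v * m, v, by rw [hu]; push_cast; ring, by rw [hv]; push_cast; ring⟩

theorem tau_mul_tau_swap {f : BQForm} (hD : 0 < f.disc) (h : ¬ IsSquare f.disc) :
    (tau f).1 * (tau (swap f)).1 = -1 ∧ (tau f).2 * (tau (swap f)).2 = -1 := by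
  have ha : (f.a : ℝ) ≠ 0 := by exact_mod_cast a_ne_zero h
  have hc : (f.c : ℝ) ≠ 0 := by
    have := a_ne_zero (f := swap f) (by rwa [disc_swap])
    exact_mod_cast this
  have hsq := sq_sqrt_disc hD
  simp only [tau, disc_swap]
  simp only [swap]
  push_cast
  constructor
  · field_simp; linear_combination hsq
  · field_simp; linear_combination hsq

theorem tau_fst_mul_snd {f : BQForm} (hD : 0 < f.disc) (ha : f.a ≠ 0) :
    (tau f).1 * (tau f).2 * (f.a * f.c) = f.c ^ 2 := by
  have ha' : (f.a : ℝ) ≠ 0 := by exact_mod_cast ha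
  have hsq := sq_sqrt_disc hD
  simp only [tau]
  field_simp
  linear_combination (- (f.c : ℝ)) * hsq

/-- In both embeddings the τ of `swap f` is -1/τ, and ℤ + ℤτ = τ(ℤ + ℤ/τ). The sign `d` makes the
factor positive in the first embedding. The norm of τ is c/a, so it has the sign of ac. -/
theorem idealRel_swap {f : BQForm} (hD : 0 < f.disc) (h : ¬ IsSquare f.disc) (d : ℤ)
    (hd : d * d = 1) (hpos : 0 < d * (tau f).1) :
    IdealRel f (swap f) (d * (tau f).1, d * (tau f).2) := by
  have ha : f.a ≠ 0 := a_ne_zero h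
  have hc : (f.c : ℝ) ≠ 0 := by
    have := a_ne_zero (f := swap f) (by rwa [disc_swap])
    exact_mod_cast this
  obtain ⟨h1, h2⟩ := tau_mul_tau_swap hD h
  have hdR : (d : ℝ) * d = 1 := by exact_mod_cast hd
  refine ⟨?_, hpos, ?_⟩
  · ext z
    rw [mem_scalar_mul, mem_fracIdeal]
    constructor
    · rintro ⟨u, v, hu, hv⟩
      refine ⟨(d * v + -(d * u) * (tau (swap f)).1, d * v + -(d * u) * (tau (swap f)).2),
        mem_fracIdeal.mpr ⟨d * v, -(d * u), by push_cast; ring, by push_cast; ring⟩, ?_⟩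
      ext
      · simp only [Prod.mk_mul_mk, hu]
        linear_combination ((v : ℝ) * (tau f).1 - u * ((tau f).1 * (tau (swap f)).1)) * hdR
          - (u : ℝ) * h1
      · simp only [Prod.mk_mul_mk, hv]
        linear_combination ((v : ℝ) * (tau f).2 - u * ((tau f).2 * (tau (swap f)).2)) * hdR
          - (u : ℝ) * h2
    · rintro ⟨w, hw, rfl⟩
      obtain ⟨u, v, hu, hv⟩ := mem_fracIdeal.mp hw
      refine ⟨-(d * v), d * u, ?_, ?_⟩
      · simp only [Prod.fst_mul, hu]; push_cast
        linear_combination ((d : ℝ) * v) * h1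
      · simp only [Prod.snd_mul, hv]; push_cast
        linear_combination ((d : ℝ) * v) * h2
  · have key := tau_fst_mul_snd hD ha
    refine pos_of_mul_pos_left (b := (d : ℝ) * (tau f).1) ?_ hpos.le
    have : (d : ℝ) * (tau f).2 * (f.a * (swap f).a) * (d * (tau f).1) = f.c ^ 2 := by
      simp only [swap]
      linear_combination ((tau f).1 * (tau f).2 * (f.a * f.c)) * hdR + key
    simp only [this]
    positivity

theorem idealRel_swap_root {f : BQForm} (hD : 0 < f.disc) (h : ¬ IsSquare f.disc) :
    ∃ y, IdealRel f (swap f) (|f.root|, y) := by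
  obtain ⟨h0, -⟩ := root_swap hD h
  obtain ⟨e, he, h1, -⟩ := exists_sign_mul_tau (a_ne_zero h)
  rcases lt_or_gt_of_ne h0 with h2 | h2
  · refine ⟨((-e : ℤ) : ℝ) * (tau f).2, ?_⟩
    rw [abs_of_neg h2, show -f.root = ((-e : ℤ) : ℝ) * (tau f).1 by rw [h1]; push_cast; ring]
    refine idealRel_swap hD h (-e) (by linarith) ?_
    push_cast
    linarith
  · refine ⟨e * (tau f).2, ?_⟩
    rw [abs_of_pos h2, h1]
    exact idealRel_swap hD h e he (by linarith)

/-- The second coordinate is left unspecified: only its sign matters later, and `IdealRel` records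
that. -/
theorem Reduces.idealRel {f h : BQForm} {θ : ℝ} (H : Reduces f h θ) (hD : 0 < f.disc)
    (hsq : ¬ IsSquare f.disc) :
    (∃ y, IdealRel f h (θ, y)) ∧ h.IsReduced ∧ h.disc = f.disc := by
  induction H with
  | done f m hn hr => exact ⟨⟨1, idealRel_translate m (a_ne_zero hsq)⟩, hr, disc_translate m f⟩
  | step f h m θ hn hr hs ih =>
    obtain ⟨⟨y, hy⟩, hred, hdisc⟩ := ih (by rwa [disc_swap, disc_translate])
      (by rwa [disc_swap, disc_translate])
    obtain ⟨y', hy'⟩ := idealRel_swap_root (f := translate m f) (by rwa [disc_translate])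
      (by rwa [disc_translate])
    refine ⟨⟨y' * y, ?_⟩, hred, by rw [hdisc, disc_swap, disc_translate]⟩
    have := (idealRel_translate m (a_ne_zero hsq)).trans (hy'.trans hy)
    rwa [one_mul] at this

/-! ### The cycle of a reduced form -/

/-- Galois's criterion for a purely periodic continued fraction. -/
theorem isReduced_iff {f : BQForm} (ha : f.a ≠ 0) :
    f.IsReduced ↔ 1 < f.root ∧ -1 < f.conjRoot ∧ f.conjRoot < 0 := by
  have h : 0 < 2 * |(f.a : ℝ)| := by
    have : (f.a : ℝ) ≠ 0 := by exact_mod_cast ha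
    positivity
  simp only [IsReduced, root, conjRoot, abs_lt, lt_div_iff₀ h, div_lt_iff₀ h]
  constructor
  · rintro ⟨⟨h1, h2⟩, h3⟩
    exact ⟨by linarith, by linarith, by linarith⟩
  · rintro ⟨h1, h2, h3⟩
    exact ⟨⟨by linarith, by linarith⟩, by linarith⟩

theorem eq_zero_of_add_mul_sqrt {D : ℤ} (hD : 0 < D) (hsq : ¬ IsSquare D) {u v : ℤ}
    (h : (u : ℝ) + v * √(D : ℝ) = 0) : u = 0 ∧ v = 0 := by
  have hv : v = 0 := by
    by_contra hv
    have hirr : Irrational √(D : ℝ) := irrational_sqrt_intCast_iff.mpr ⟨hsq, hD.le⟩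
    refine hirr ⟨-u / v, ?_⟩
    have hv' : (v : ℝ) ≠ 0 := by exact_mod_cast hv
    push_cast
    field_simp
    linarith
  subst hv
  simpa using h

theorem eq_zero_of_add_mul_root {f : BQForm} (hD : 0 < f.disc) (hsq : ¬ IsSquare f.disc)
    {u v : ℤ} (h : (u : ℝ) + v * f.root = 0) : u = 0 ∧ v = 0 := by
  have ha := a_ne_zero hsq
  have hb : 0 < |(f.a : ℝ)| := abs_pos.mpr (by exact_mod_cast ha)
  have h' : ((u * (2 * |f.a|) + v * f.b : ℤ) : ℝ) + v * √(f.disc : ℝ) = 0 := by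
    simp only [root] at h
    push_cast
    field_simp at h
    linear_combination h
  obtain ⟨h1, h2⟩ := eq_zero_of_add_mul_sqrt hD hsq h'
  subst h2
  simpa [ha] using h1

theorem eq_of_root_eq {f g : BQForm} (hD : 0 < f.disc) (hsq : ¬ IsSquare f.disc)
    (hg : g.disc = f.disc) (hr : f.root = g.root) (hs : f.a.sign = g.a.sign) : f = g := by
  have ha := a_ne_zero hsq
  have ha' : g.a ≠ 0 := a_ne_zero (by rwa [hg])
  have hb : 0 < |(f.a : ℝ)| := abs_pos.mpr (by exact_mod_cast ha)
  have hb' : 0 < |(g.a : ℝ)| := abs_pos.mpr (by exact_mod_cast ha')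
  have key : ((f.b * |g.a| - g.b * |f.a| : ℤ) : ℝ) + ((|g.a| - |f.a| : ℤ) : ℝ) * √(f.disc : ℝ)
      = 0 := by
    simp only [root, hg] at hr
    push_cast
    field_simp at hr
    linear_combination hr
  obtain ⟨h1, h2⟩ := eq_zero_of_add_mul_sqrt hD hsq key
  have habs : |f.a| = |g.a| := by linarith
  have haa : f.a = g.a := by rw [← Int.sign_mul_abs f.a, ← Int.sign_mul_abs g.a, hs, habs]
  have hbb : f.b = g.b := by
    rw [habs, ← sub_mul] at h1
    rcases mul_eq_zero.mp h1 with h | h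
    · linarith
    · exact absurd (abs_eq_zero.mp h) ha'
  have hcc : f.c = g.c := by
    simp only [disc, ← haa, ← hbb] at hg
    have : f.a * f.c = f.a * g.c := by linarith
    exact mul_left_cancel₀ ha this
  exact BQForm.ext haa hbb hcc

/-- The successor of a reduced form in its cycle. -/
noncomputable def next (f : BQForm) : BQForm :=
  swap (translate (-(f.a.sign * ⌊f.root⌋)) f)

theorem disc_next (f : BQForm) : (next f).disc = f.disc := by
  rw [next, disc_swap, disc_translate]

theorem disc_iterate_next (f : BQForm) (n : ℕ) : (next^[n] f).disc = f.disc := by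
  induction n with
  | zero => rfl
  | succ n ih => rw [Function.iterate_succ_apply', disc_next, ih]

theorem root_translate_sign (m : ℤ) {f : BQForm} (ha : f.a ≠ 0) :
    (translate m f).root = f.root + f.a.sign * m ∧
      (translate m f).conjRoot = f.conjRoot + f.a.sign * m := by
  obtain ⟨e, he, hea, hs⟩ := exists_sign_mul_abs f.a ha
  have ha' : (f.a : ℝ) ≠ 0 := by exact_mod_cast ha
  have heR : (e : ℝ) * e = 1 := by exact_mod_cast he
  have hb : |(f.a : ℝ)| ≠ 0 := abs_ne_zero.mpr ha'
  have hs' : (f.a : ℝ) = e * |(f.a : ℝ)| := by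
    rw [hea]; linear_combination (-(f.a : ℝ)) * heR
  simp only [root, conjRoot, disc_translate, hs]
  simp only [translate]
  push_cast
  constructor
  · field_simp
    linear_combination (2 * (m : ℝ)) * hs'
  · field_simp
    linear_combination (2 * (m : ℝ)) * hs'

/-- The data of the successor of a reduced form. -/
structure NextSpec (f : BQForm) : Prop where
  root_eq : (next f).root = 1 / Int.fract f.root
  sign_eq : (next f).a.sign = -f.a.sign
  isReduced : (next f).IsReduced
  rel : IdealRel f (next f) (Int.fract f.root, f.conjRoot - ⌊f.root⌋)
  fract_pos : 0 < Int.fract f.root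
  conj_lt : f.conjRoot - ⌊f.root⌋ < -1

/-- Subtracting the floor moves the root into (0, 1) and its conjugate below -1. The outer
coefficients then have opposite signs, so the swap inverts both numbers exactly and changes the sign
of the leading coefficient. -/
theorem IsReduced.nextSpec {f : BQForm} (hf : f.IsReduced) (hD : 0 < f.disc)
    (hsq : ¬ IsSquare f.disc) : NextSpec f := by
  have ha := a_ne_zero hsq
  obtain ⟨h1, h2, h3⟩ := (isReduced_iff ha).mp hf
  set q := ⌊f.root⌋ with hq
  set m : ℤ := -(f.a.sign * q) with hm
  set g := translate m f with hg
  have hgD : 0 < g.disc := by rwa [hg, disc_translate]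
  have hgsq : ¬ IsSquare g.disc := by rwa [hg, disc_translate]
  have hnext : next f = swap g := rfl
  have hga : g.a = f.a := rfl
  have hga0 : g.a ≠ 0 := ha
  have hsD : 0 < (swap g).disc := by rwa [disc_swap]
  have hssq : ¬ IsSquare (swap g).disc := by rwa [disc_swap]
  have hc0 : (swap g).a ≠ 0 := a_ne_zero hssq
  obtain ⟨hr, hcr⟩ := root_translate_sign m ha
  have hss : (f.a.sign : ℝ) * f.a.sign = 1 := by
    obtain ⟨e, he, -, hs⟩ := exists_sign_mul_abs f.a ha
    rw [hs]; exact_mod_cast he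
  have hr' : g.root = f.root - q := by
    rw [hr, hm]; push_cast; linear_combination (-(q : ℝ)) * hss
  have hcr' : g.conjRoot = f.conjRoot - q := by
    rw [hcr, hm]; push_cast; linear_combination (-(q : ℝ)) * hss
  have hq1 : (1 : ℝ) ≤ q := by
    have : (1 : ℤ) ≤ q := Int.le_floor.mpr (by push_cast; linarith)
    exact_mod_cast this
  have hfr : Int.fract f.root = g.root := by rw [hr', Int.fract]
  have hg0 : g.root ≠ 0 := (root_swap hgD hgsq).1
  have hpos : 0 < g.root := lt_of_le_of_ne (hfr ▸ Int.fract_nonneg _) hg0.symm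
  have hlt : g.root < 1 := hfr ▸ Int.fract_lt_one _
  have hcneg : g.conjRoot < -1 := by rw [hcr']; linarith
  obtain ⟨e, he, he1, he2, hea, hes⟩ := exists_sign_mul_tau hga0
  obtain ⟨d, hd, hd1, hd2, hda, hds⟩ := exists_sign_mul_tau hc0
  have heR : (e : ℝ) * e = 1 := by exact_mod_cast he
  have hdR : (d : ℝ) * d = 1 := by exact_mod_cast hd
  have hsca : (swap g).a = g.c := rfl
  -- the outer coefficients have opposite signs
  have hac : (g.a : ℝ) * g.c < 0 := by
    have key := tau_fst_mul_snd hgD hga0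
    have h4 : g.root * g.conjRoot * (g.a * g.c) = g.c ^ 2 := by
      rw [he1, he2]; linear_combination ((tau g).1 * (tau g).2 * (g.a * g.c)) * heR + key
    have h5 : g.root * g.conjRoot < 0 := mul_neg_of_pos_of_neg hpos (by linarith)
    have h6 : (0 : ℝ) < g.c ^ 2 := by
      have : (g.c : ℝ) ≠ 0 := by exact_mod_cast hc0
      positivity
    rw [← h4] at h6
    exact neg_of_mul_pos_right h6 h5.le
  have hac' : g.a * g.c < 0 := by exact_mod_cast hac
  have hed : d = -e := by
    rw [← hes, ← hds, hsca]
    rcases lt_or_gt_of_ne hga0 with h | h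
    · rw [Int.sign_eq_neg_one_of_neg h, Int.sign_eq_one_of_pos (by nlinarith)]; rfl
    · rw [Int.sign_eq_one_of_pos h, Int.sign_eq_neg_one_of_neg (by nlinarith)]
  have hedR : (d : ℝ) = -e := by rw [hed]; push_cast; ring
  obtain ⟨ht1, ht2⟩ := tau_mul_tau_swap hgD hgsq
  have hroot : (swap g).root = 1 / g.root := by
    rw [eq_div_iff hg0, hd1, he1, hedR]
    linear_combination -(tau g).1 * (tau (swap g)).1 * heR - ht1
  have hconj : (swap g).conjRoot = 1 / g.conjRoot := by
    rw [eq_div_iff (by linarith), hd2, he2, hedR]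
    linear_combination -(tau g).2 * (tau (swap g)).2 * heR - ht2
  refine ⟨by rw [hnext, hfr, hroot], ?_, ?_, ?_, by rw [hfr]; exact hpos, by rw [← hcr']; exact hcneg⟩
  · rw [hnext, hds, hed, ← hga, hes]
  · rw [hnext, isReduced_iff hc0, hroot, hconj]
    refine ⟨by rw [lt_div_iff₀ hpos]; linarith, ?_, div_neg_of_pos_of_neg one_pos (by linarith)⟩
    rw [lt_div_iff_of_neg (by linarith)]; linarith
  · rw [hnext, hfr, ← hcr', he1, he2]
    have := (idealRel_translate m ha).trans
      (idealRel_swap hgD hgsq e he (by rw [← he1]; exact hpos))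
    rwa [one_mul] at this

theorem IsReduced.iterate_next {f : BQForm} (hf : f.IsReduced) (hD : 0 < f.disc)
    (hsq : ¬ IsSquare f.disc) (n : ℕ) :
    (next^[n] f).IsReduced ∧ (next^[n] f).root = completeQuotient f.root n ∧
      (next^[n] f).a.sign = (-1) ^ n * f.a.sign := by
  induction n with
  | zero => exact ⟨hf, rfl, by simp⟩
  | succ n ih =>
    obtain ⟨h1, h2, h3⟩ := ih
    have hs := h1.nextSpec (by rwa [disc_iterate_next]) (by rwa [disc_iterate_next])
    rw [Function.iterate_succ_apply']
    refine ⟨hs.isReduced, ?_, ?_⟩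
    · rw [hs.root_eq, h2]; rfl
    · rw [hs.sign_eq, h3]; ring

/-- Since √D is irrational, the root and the sign of a determine the form. Complete quotients can
therefore be replaced by iteration of `next`. -/
theorem IsReduced.isTerm_iff {f g : BQForm} (hf : f.IsReduced) (hD : 0 < f.disc)
    (hsq : ¬ IsSquare f.disc) (hg : g.disc = f.disc) (n : ℕ) :
    IsTerm f g n ↔ g = next^[n] f := by
  obtain ⟨-, h2, h3⟩ := hf.iterate_next hD hsq n
  constructor
  · rintro ⟨hr, hs⟩
    exact eq_of_root_eq (by rwa [hg]) (by rwa [hg]) (by rw [disc_iterate_next, hg])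
      (by rw [hr, h2]) (by rw [hs, h3])
  · rintro rfl
    exact ⟨h2, h3⟩

/-- The factor by which the lattice of the `n`-th form of the cycle has to be multiplied to give
the lattice of `f`. -/
noncomputable def contract (f : BQForm) (n : ℕ) : ℝ :=
  ∏ k ∈ Finset.range n, Int.fract (next^[k] f).root

theorem contract_zero (f : BQForm) : contract f 0 = 1 := by simp [contract]

theorem contract_add (f : BQForm) (m n : ℕ) :
    contract f (m + n) = contract f m * contract (next^[m] f) n := by
  simp only [contract, Finset.prod_range_add, ← Function.iterate_add_apply, add_comm]

theorem IsReduced.contract_pos {f : BQForm} (hf : f.IsReduced) (hD : 0 < f.disc)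
    (hsq : ¬ IsSquare f.disc) (n : ℕ) : 0 < contract f n := by
  refine Finset.prod_pos fun k _ => ?_
  exact ((hf.iterate_next hD hsq k).1.nextSpec (by rwa [disc_iterate_next])
    (by rwa [disc_iterate_next])).fract_pos

theorem IsReduced.cycleLog_eq {f : BQForm} (hf : f.IsReduced) (hD : 0 < f.disc)
    (hsq : ¬ IsSquare f.disc) (n : ℕ) : cycleLog f n = -Real.log (contract f n) := by
  -- The factor x_{k+1} is the reciprocal of the fractional part of x_k, hence the index shift by
  -- one.
  rw [cycleLog, ← Real.log_inv, contract, ← Finset.prod_inv_distrib, Finset.range_eq_Ico,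
    ← Finset.Ico_add_one_right_eq_Icc, ← zero_add 1, ← Finset.prod_Ico_add']
  congr 1
  refine Finset.prod_congr rfl fun k _ => ?_
  rw [(hf.iterate_next hD hsq k).2.1, completeQuotient, one_div]
  rfl

theorem IsReduced.idealRel_iterate {f : BQForm} (hf : f.IsReduced) (hD : 0 < f.disc)
    (hsq : ¬ IsSquare f.disc) (n : ℕ) : ∃ y, IdealRel f (next^[n] f) (contract f n, y) := by
  induction n with
  | zero => exact ⟨1, by rw [contract_zero]; exact IdealRel.refl (a_ne_zero hsq)⟩
  | succ n ih =>
    obtain ⟨y, hy⟩ := ih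
    have hs := (hf.iterate_next hD hsq n).1.nextSpec (by rwa [disc_iterate_next])
      (by rwa [disc_iterate_next])
    refine ⟨y * ((next^[n] f).conjRoot - ⌊(next^[n] f).root⌋), ?_⟩
    rw [Function.iterate_succ_apply', contract, Finset.prod_range_succ]
    exact hy.trans hs.rel

/-- `1` is a minimum of the lattice of a reduced form. -/
theorem IsReduced.one_le_abs_snd {g : BQForm} (hg : g.IsReduced) (ha : g.a ≠ 0) {z : ℝ × ℝ}
    (hz : z ∈ fracIdeal g) (h0 : 0 < z.1) (h1 : z.1 < 1) : 1 ≤ |z.2| := by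
  obtain ⟨hr, hc1, hc2⟩ := (isReduced_iff ha).mp hg
  obtain ⟨u, v, hu, hv⟩ := (mem_fracIdeal_iff_root ha).mp hz
  rw [hu] at h0 h1
  rw [hv]
  -- For v < 0, positivity of z.1 forces u ≥ 1, and v times the negative conjugate only adds to it.
  -- For v > 0, z.1 < 1 < root forces u ≤ -1, and the conjugate term only lowers it. For v = 0 an
  -- integer would lie in (0, 1).
  rcases lt_trichotomy v 0 with h | h | h
  · have h' : (v : ℝ) ≤ -1 := by exact_mod_cast Int.le_sub_one_of_lt h
    have : (0 : ℝ) < u := by nlinarith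
    have : (1 : ℝ) ≤ u := by exact_mod_cast (by exact_mod_cast this : (0 : ℤ) < u)
    exact le_abs.mpr (Or.inl (by nlinarith))
  · subst h
    simp only [Int.cast_zero, zero_mul, add_zero] at h0 h1 ⊢
    have h2 : (0 : ℤ) < u := by exact_mod_cast h0
    have h3 : u < (1 : ℤ) := by exact_mod_cast h1
    omega
  · have h' : (1 : ℝ) ≤ v := by exact_mod_cast h
    have : (u : ℝ) < 0 := by nlinarith
    have : (u : ℝ) ≤ -1 := by
      exact_mod_cast Int.le_sub_one_of_lt (by exact_mod_cast this : u < (0 : ℤ))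
    exact le_abs.mpr (Or.inr (by nlinarith))

/-- There is no relative minimum strictly between two consecutive ones. -/
theorem IdealRel.eq_one_or_le {f g : BQForm} {l : ℝ × ℝ} (H : IdealRel f g l)
    (hf : f.IsReduced) (hg : g.IsReduced) (hD : 0 < f.disc) (hsq : ¬ IsSquare f.disc)
    (hga : g.a ≠ 0) (hl : l.1 ≤ 1) : l.1 = 1 ∨ l.1 ≤ Int.fract f.root := by
  have ha := a_ne_zero hsq
  have hs := hf.nextSpec hD hsq
  obtain ⟨hr, hc1, hc2⟩ := (isReduced_iff ha).mp hf
  have hfr1 := Int.fract_lt_one f.root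
  have hfrp := hs.fract_pos
  have hc := hs.conj_lt
  by_contra! hcon
  obtain ⟨hne, hlt⟩ := hcon
  have hl1 : l.1 < 1 := lt_of_le_of_ne hl hne
  -- γ is the minimum following 1. The claim is that `l` cannot have first coordinate strictly
  -- between those of γ and 1.
  set γ : ℝ × ℝ := (Int.fract f.root, f.conjRoot - ⌊f.root⌋) with hγ
  have hγmem : γ ∈ fracIdeal f := by
    refine (mem_fracIdeal_iff_root ha).mpr ⟨-⌊f.root⌋, 1, ?_, ?_⟩
    · simp only [hγ, Int.fract]; push_cast; ring
    · simp only [hγ]; push_cast; ring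
  have hlmem : l ∈ fracIdeal f := by
    rw [H.eq, mem_scalar_mul]
    exact ⟨1, mem_fracIdeal.mpr ⟨1, 0, by simp, by simp⟩, mul_one l⟩
  -- The quotient w = γ/l lies in the lattice of `g` with 0 < w.1 < 1. As 1 is a minimum there,
  -- |w.2| ≥ 1.
  have hbound : |l.2| ≤ |γ.2| := by
    rw [H.eq, mem_scalar_mul] at hγmem
    obtain ⟨w, hw, hwe⟩ := hγmem
    have e1 : l.1 * w.1 = Int.fract f.root := congrArg Prod.fst hwe
    have hw0 : 0 < w.1 := by
      rw [← e1] at hfrp; exact pos_of_mul_pos_right hfrp H.fst_pos.le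
    have hw1 : w.1 < 1 := by
      rw [← e1] at hlt
      by_contra! h
      nlinarith [H.fst_pos]
    have := hg.one_le_abs_snd hga hw hw0 hw1
    rw [← hwe, Prod.snd_mul, abs_mul]
    exact le_mul_of_one_le_right (abs_nonneg _) this
  obtain ⟨u, v, hu, hv⟩ := (mem_fracIdeal_iff_root ha).mp hlmem
  -- coordinates of `l` with respect to `1, γ`
  set u' : ℤ := u + v * ⌊f.root⌋ with hu'
  have hl1' : l.1 = u' + v * Int.fract f.root := by
    rw [hu, hu', Int.fract]; push_cast; ring
  have hl2' : l.2 = u' + v * (f.conjRoot - ⌊f.root⌋) := by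
    rw [hv, hu']; push_cast; ring
  rw [abs_of_neg (show γ.2 < 0 by simp only [hγ]; linarith), abs_le] at hbound
  simp only [hγ, neg_neg, hl2'] at hbound
  obtain ⟨hb1, hb2⟩ := hbound
  rw [hl1'] at hlt hl1
  set x := Int.fract f.root
  set y := f.conjRoot - ⌊f.root⌋
  -- Here x < u' + vx < 1 and |u' + vy| ≤ -y with y < -1. If v < 0 then u' ≥ 1 and u' + vy > -y. If
  -- v > 0 then either u' < 0, or u' = 0 and v > 1; both give u' + vy < y.
  rcases lt_trichotomy v 0 with h | h | h
  · have h' : (v : ℝ) ≤ -1 := by exact_mod_cast Int.le_sub_one_of_lt h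
    have : (0 : ℝ) < u' := by nlinarith
    nlinarith
  · subst h
    simp only [Int.cast_zero, zero_mul, add_zero] at hlt hl1
    have h2 : (0 : ℤ) < u' := by exact_mod_cast hfrp.trans hlt
    have h3 : u' < (1 : ℤ) := by exact_mod_cast hl1
    omega
  · have h' : (1 : ℝ) ≤ v := by exact_mod_cast h
    have h0 : (u' : ℝ) < 1 := by nlinarith
    have h0' : u' ≤ (0 : ℤ) := by
      have : u' < (1 : ℤ) := by exact_mod_cast h0
      omega
    rcases h0'.lt_or_eq with h1 | h1
    · have : (u' : ℝ) < 0 := by exact_mod_cast h1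
      nlinarith
    · rw [h1] at hlt hb1
      push_cast at hlt hb1
      have : (1 : ℝ) < v := by nlinarith
      nlinarith

/-- Irrationality makes the first embedding injective on the lattice, so l = 1 and the lattices
coincide. Writing `f.root` as p + q times `g.root`, the positive differences root minus conjugate
give q = 1, and both conjugates lying in (-1, 0) give p = 0. -/
theorem IdealRel.eq_of_fst_eq_one {f g : BQForm} {l : ℝ × ℝ} (H : IdealRel f g l)
    (hf : f.IsReduced) (hg : g.IsReduced) (hD : 0 < f.disc) (hsq : ¬ IsSquare f.disc)
    (hgd : g.disc = f.disc) (hl : l.1 = 1) : f = g := by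
  have ha := a_ne_zero hsq
  have hga : g.a ≠ 0 := a_ne_zero (by rwa [hgd])
  have hlmem : l ∈ fracIdeal f := by
    rw [H.eq, mem_scalar_mul]
    exact ⟨1, mem_fracIdeal.mpr ⟨1, 0, by simp, by simp⟩, mul_one l⟩
  obtain ⟨u, v, hu, hv⟩ := (mem_fracIdeal_iff_root ha).mp hlmem
  obtain ⟨h1, h2⟩ := eq_zero_of_add_mul_root hD hsq (u := u - 1) (v := v)
    (by push_cast; linarith)
  have hl1 : l = 1 := by
    ext
    · simpa using hl
    · rw [hv, h2, show u = 1 by linarith]; simp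
  have heq : fracIdeal f = fracIdeal g := by rw [H.eq, hl1, scalar_one, one_mul]
  have hsgn : 0 < (f.a : ℝ) * g.a := by have := H.sign; simpa [hl1] using this
  have hsgn' : 0 < f.a * g.a := by exact_mod_cast hsgn
  obtain ⟨hr, hc1, hc2⟩ := (isReduced_iff ha).mp hf
  obtain ⟨hr', hc1', hc2'⟩ := (isReduced_iff hga).mp hg
  have hx : ((f.root, f.conjRoot) : ℝ × ℝ) ∈ fracIdeal g := by
    rw [← heq]; exact (mem_fracIdeal_iff_root ha).mpr ⟨0, 1, by simp, by simp⟩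
  have hy : ((g.root, g.conjRoot) : ℝ × ℝ) ∈ fracIdeal f := by
    rw [heq]; exact (mem_fracIdeal_iff_root hga).mpr ⟨0, 1, by simp, by simp⟩
  obtain ⟨p, q, hp1, hp2⟩ := (mem_fracIdeal_iff_root hga).mp hx
  obtain ⟨r, s, hr1, hr2⟩ := (mem_fracIdeal_iff_root ha).mp hy
  simp only at hp1 hp2 hr1 hr2
  have e1 : f.root - f.conjRoot = q * (g.root - g.conjRoot) := by rw [hp1, hp2]; ring
  have e2 : g.root - g.conjRoot = s * (f.root - f.conjRoot) := by
    linear_combination hr1 - hr2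
  have d1 : 0 < f.root - f.conjRoot := by linarith
  have d2 : 0 < g.root - g.conjRoot := by linarith
  have hq : (0 : ℝ) < q := by rw [e1] at d1; exact pos_of_mul_pos_left d1 d2.le
  have hs : (0 : ℝ) < s := by rw [e2] at d2; exact pos_of_mul_pos_left d2 d1.le
  have hqs : (q : ℝ) * s = 1 := by
    have : (q * s - 1 : ℝ) * (f.root - f.conjRoot) = 0 := by
      linear_combination -e1 - (q : ℝ) * e2
    rcases mul_eq_zero.mp this with h | h
    · linarith
    · linarith
  have hq1 : q = 1 := by
    have h1 : (0 : ℤ) < q := by exact_mod_cast hq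
    have h2 : q * s = 1 := by exact_mod_cast hqs
    exact Int.eq_one_of_mul_eq_one_right h1.le h2
  subst hq1
  have hp : p = 0 := by
    have h1 : (p : ℝ) < 1 := by push_cast at hp2; linarith
    have h2 : (-1 : ℝ) < p := by push_cast at hp2; linarith
    have h1' : p < (1 : ℤ) := by exact_mod_cast h1
    have h2' : (-1 : ℤ) < p := by exact_mod_cast h2
    omega
  subst hp
  refine eq_of_root_eq hD hsq hgd (by simpa using hp1) ?_
  rcases lt_or_gt_of_ne ha with h | h
  · rw [Int.sign_eq_neg_one_of_neg h, Int.sign_eq_neg_one_of_neg (by nlinarith)]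
  · rw [Int.sign_eq_one_of_pos h, Int.sign_eq_one_of_pos (by nlinarith)]

theorem IdealRel.next {f g : BQForm} {l : ℝ × ℝ} (H : IdealRel f g l) (hs : NextSpec f) :
    ∃ y, IdealRel (next f) g (l.1 / Int.fract f.root, y) := by
  have := hs.rel.symm.trans H
  refine ⟨(f.conjRoot - ⌊f.root⌋)⁻¹ * l.2, ?_⟩
  rw [div_eq_inv_mul]
  exact this

/-- One fractional part γ may be close to 1, but the product of two consecutive ones is at most 1 -
γ and less than γ. This makes the walk along the cycle terminate. -/
theorem fract_mul_fract_inv_lt {x : ℝ} (h0 : 0 < Int.fract x) :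
    Int.fract x * Int.fract (1 / Int.fract x) ≤ 1 / 2 := by
  set γ := Int.fract x
  have h1 : γ < 1 := Int.fract_lt_one x
  have h2 : (1 : ℝ) ≤ ⌊1 / γ⌋ := by
    have : (1 : ℤ) ≤ ⌊1 / γ⌋ := Int.le_floor.mpr (by
      push_cast; rw [le_div_iff₀ h0]; linarith)
    exact_mod_cast this
  have h3 : γ * Int.fract (1 / γ) = 1 - γ * ⌊1 / γ⌋ := by
    rw [Int.fract]; field_simp
  have h4 := Int.fract_lt_one (1 / γ)
  nlinarith

/-- Reduced forms with similar lattices lie on the same cycle. -/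
theorem IdealRel.exists_iterate {g : BQForm} (hg : g.IsReduced) (hD : 0 < g.disc)
    (hsq : ¬ IsSquare g.disc) {l : ℝ × ℝ} {f : BQForm} (H : IdealRel f g l)
    (hf : f.IsReduced) (hfd : f.disc = g.disc) (hl : l.1 ≤ 1) :
    ∃ n, g = BQForm.next^[n] f ∧ l.1 = contract f n := by
  -- Induction on N with (1/2)^N < l.1: two steps of the cycle divide l.1 by at most 1/2, so the
  -- bound holds with N - 1 afterwards.
  obtain ⟨N, hN⟩ := exists_pow_lt_of_lt_one H.fst_pos (show (1 / 2 : ℝ) < 1 by norm_num)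
  induction N using Nat.strong_induction_on generalizing f l with
  | _ N ih =>
  have hga := a_ne_zero hsq
  have hfD : 0 < f.disc := by rwa [hfd]
  have hfsq : ¬ IsSquare f.disc := by rwa [hfd]
  rcases H.eq_one_or_le hf hg hfD hfsq hga hl with h | h
  · exact ⟨0, (H.eq_of_fst_eq_one hf hg hfD hfsq hfd.symm h).symm, by rw [contract_zero, h]⟩
  have hs := hf.nextSpec hfD hfsq
  obtain ⟨y, hy⟩ := H.next hs
  have hl' : l.1 / Int.fract f.root ≤ 1 := (div_le_one hs.fract_pos).mpr h
  have hnd := disc_next f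
  have hnD : 0 < (BQForm.next f).disc := by rwa [hnd]
  have hnsq : ¬ IsSquare (BQForm.next f).disc := by rwa [hnd]
  rcases hy.eq_one_or_le hs.isReduced hg hnD hnsq hga hl' with h' | h'
  · refine ⟨1, (hy.eq_of_fst_eq_one hs.isReduced hg hnD hnsq (by rw [hnd, hfd]) h').symm, ?_⟩
    simp only [contract, Finset.prod_range_one, Function.iterate_zero, id]
    exact (div_eq_one_iff_eq hs.fract_pos.ne').mp h'
  have hs' := hs.isReduced.nextSpec hnD hnsq
  obtain ⟨y', hy'⟩ := hy.next hs'
  have hprod := fract_mul_fract_inv_lt hs.fract_pos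
  rw [← hs.root_eq] at hprod
  have hpp := mul_pos hs.fract_pos hs'.fract_pos
  have hl'' : l.1 / Int.fract f.root / Int.fract (BQForm.next f).root ≤ 1 :=
    (div_le_one hs'.fract_pos).mpr h'
  have hN0 : N ≠ 0 := by rintro rfl; norm_num at hN; linarith
  obtain ⟨M, rfl⟩ := Nat.exists_eq_succ_of_ne_zero hN0
  have hM : (1 / 2 : ℝ) ^ M < l.1 / Int.fract f.root / Int.fract (BQForm.next f).root := by
    rw [div_div, lt_div_iff₀ hpp]
    calc (1 / 2 : ℝ) ^ M * _ ≤ (1 / 2 : ℝ) ^ M * (1 / 2) := by gcongr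
      _ = (1 / 2 : ℝ) ^ (M + 1) := by ring
      _ < l.1 := hN
  obtain ⟨n, hn1, hn2⟩ := ih M (Nat.lt_succ_self M) hy' hs'.isReduced
    (by rw [disc_next, disc_next, hfd]) hl'' hM
  refine ⟨2 + n, ?_, ?_⟩
  · rw [add_comm, Function.iterate_add_apply]; exact hn1
  · rw [contract_add]
    simp only [Function.iterate_succ_apply, Function.iterate_zero, id]
    rw [← hn2]
    simp only [contract, Finset.prod_range_succ, Finset.prod_range_zero, one_mul,
      Function.iterate_succ_apply, Function.iterate_zero, id]
    have := hs.fract_pos.ne'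
    have := hs'.fract_pos.ne'
    field_simp

/-! ### Proper equivalence and similarity of lattices -/

theorem coeff_of_eval {f g : BQForm} {s t u v : ℤ}
    (h : ∀ x y : ℤ, g.eval x y = f.eval (s * x + t * y) (u * x + v * y)) :
    g.a = f.eval s u ∧ g.c = f.eval t v ∧
      g.b = 2 * f.a * s * t + f.b * (s * v + t * u) + 2 * f.c * u * v := by
  have h1 := h 1 0
  have h2 := h 0 1
  have h3 := h 1 1
  simp only [eval] at h1 h2 h3 ⊢
  refine ⟨by linear_combination h1, by linear_combination h2, by linear_combination h3 - h1 - h2⟩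

theorem disc_eq_of_eval {f g : BQForm} {s t u v : ℤ} (hdet : s * v - t * u = 1)
    (h : ∀ x y : ℤ, g.eval x y = f.eval (s * x + t * y) (u * x + v * y)) :
    g.disc = f.disc := by
  obtain ⟨h1, h2, h3⟩ := coeff_of_eval h
  have : g.disc = f.disc * (s * v - t * u) ^ 2 := by
    simp only [disc, h1, h2, h3, eval]; ring
  rw [this, hdet]; ring

theorem ProperlyEquiv.disc_eq {f g : BQForm} (H : f.ProperlyEquiv g) : g.disc = f.disc := by
  obtain ⟨s, t, u, v, hdet, h⟩ := H
  exact disc_eq_of_eval hdet h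

theorem isPrimitive_iff (f : BQForm) :
    f.IsPrimitive ↔ ∀ d : ℤ, d ∣ f.a → d ∣ f.b → d ∣ f.c → IsUnit d := by
  rw [IsPrimitive]
  constructor
  · intro h d ha hb hc
    have h1 : d ∣ ((Int.gcd f.a (Int.gcd f.b f.c : ℤ) : ℕ) : ℤ) :=
      Int.dvd_coe_gcd ha (Int.dvd_coe_gcd hb hc)
    rw [h] at h1
    exact isUnit_of_dvd_one (by exact_mod_cast h1)
  · intro h
    have h1 := Int.gcd_dvd_right f.a (Int.gcd f.b f.c : ℤ)
    have := h (Int.gcd f.a (Int.gcd f.b f.c : ℤ) : ℕ) (Int.gcd_dvd_left ..)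
      (h1.trans (Int.gcd_dvd_left ..)) (h1.trans (Int.gcd_dvd_right ..))
    simpa [Int.isUnit_iff_natAbs_eq] using this

/-- Equivalent forms take the same values, and the values at (1, 0), (0, 1), (1, 1) recover the
coefficients. -/
theorem ProperlyEquiv.isPrimitive {f g : BQForm} (H : f.ProperlyEquiv g) (hf : f.IsPrimitive) :
    g.IsPrimitive := by
  obtain ⟨s, t, u, v, hdet, h⟩ := H
  have hval : ∀ x y : ℤ, f.eval x y = g.eval (v * x - t * y) (s * y - u * x) := by
    intro x y
    rw [h]
    congr 1
    · linear_combination (-x) * hdet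
    · linear_combination (-y) * hdet
  rw [isPrimitive_iff] at hf ⊢
  intro d ha hb hc
  have hd : ∀ x y : ℤ, d ∣ g.eval x y := fun x y =>
    dvd_add (dvd_add (ha.mul_right _) ((hb.mul_right _).mul_right _)) (hc.mul_right _)
  have hd' : ∀ x y : ℤ, d ∣ f.eval x y := fun x y => by rw [hval]; exact hd _ _
  have h10 := hd' 1 0
  have h01 := hd' 0 1
  have h11 := dvd_sub (dvd_sub (hd' 1 1) h10) h01
  simp only [eval] at h10 h01 h11
  ring_nf at h10 h01 h11
  exact hf d h10 h11 h01

theorem tau_mul_eq {f g : BQForm} {s t u v : ℤ} (hD : 0 < f.disc) (hsq : ¬ IsSquare f.disc)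
    (hdet : s * v - t * u = 1)
    (h : ∀ x y : ℤ, g.eval x y = f.eval (s * x + t * y) (u * x + v * y)) :
    ((s + u * (tau f).1) * (tau g).1 = t + v * (tau f).1 ∧
      (s + u * (tau f).2) * (tau g).2 = t + v * (tau f).2) ∧
      f.a * ((s + u * (tau f).1) * (s + u * (tau f).2)) = (g.a : ℝ) := by
  have hd := disc_eq_of_eval hdet h
  have ha : (f.a : ℝ) ≠ 0 := by exact_mod_cast a_ne_zero hsq
  have hg : (g.a : ℝ) ≠ 0 := by exact_mod_cast a_ne_zero (f := g) (by rwa [hd])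
  obtain ⟨h1, h2, h3⟩ := coeff_of_eval h
  have hs := sq_sqrt_disc hD
  have hdet' : (s : ℝ) * v - t * u = 1 := by exact_mod_cast hdet
  have h1' : (g.a : ℝ) = f.a * s ^ 2 + f.b * s * u + f.c * u ^ 2 := by
    rw [h1, eval]; push_cast; ring
  have h3' : (g.b : ℝ) = 2 * f.a * s * t + f.b * (s * v + t * u) + 2 * f.c * u * v := by
    rw [h3]; push_cast; ring
  simp only [tau, hd]
  set w := √(f.disc : ℝ)
  refine ⟨⟨?_, ?_⟩, ?_⟩
  · field_simp
    rw [h1', h3']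
    linear_combination ((u : ℝ) * (s * v - t * u)) * hs
      - ((2 * f.a * s + u * (f.b + w)) * w) * hdet'
  · field_simp
    rw [h1', h3']
    linear_combination ((u : ℝ) * (s * v - t * u)) * hs
      + ((2 * f.a * s + u * (f.b - w)) * w) * hdet'
  · field_simp
    rw [h1']
    linear_combination (-(u : ℝ) ^ 2) * hs

/-- With λ = s + uτ_f one has λτ_g = t + vτ_f, so the unimodular matrix expresses the basis λ, λτ_g
in terms of 1, τ_f. The norm of λ is g.a/f.a, which gives the sign condition; ±λ is chosen positive
in the first embedding. -/
theorem ProperlyEquiv.exists_idealRel {f g : BQForm} (H : f.ProperlyEquiv g) (hD : 0 < f.disc)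
    (hsq : ¬ IsSquare f.disc) : ∃ l, IdealRel f g l := by
  have hd := H.disc_eq
  obtain ⟨s, t, u, v, hdet, h⟩ := H
  obtain ⟨⟨h1, h2⟩, h3⟩ := tau_mul_eq hD hsq hdet h
  have ha : (f.a : ℝ) ≠ 0 := by exact_mod_cast a_ne_zero hsq
  have hg : (g.a : ℝ) ≠ 0 := by exact_mod_cast a_ne_zero (f := g) (by rwa [hd])
  have hdet' : (s : ℝ) * v - t * u = 1 := by exact_mod_cast hdet
  obtain ⟨e, he, hpos⟩ : ∃ e : ℤ, e * e = 1 ∧ 0 < e * (s + u * (tau f).1) := by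
    have h0 : (s + u * (tau f).1) ≠ 0 := by
      intro h0; rw [h0] at h3; exact hg (by rw [← h3]; ring)
    rcases lt_or_gt_of_ne h0 with h0 | h0
    · exact ⟨-1, by norm_num, by push_cast; linarith⟩
    · exact ⟨1, by norm_num, by push_cast; linarith⟩
  have heR : (e : ℝ) * e = 1 := by exact_mod_cast he
  refine ⟨(e * (s + u * (tau f).1), e * (s + u * (tau f).2)), ?_, hpos, ?_⟩
  · ext z
    rw [mem_scalar_mul, mem_fracIdeal]
    constructor
    · rintro ⟨m, n, hm, hn⟩
      refine ⟨(((e * (m * v - n * t) : ℤ) : ℝ) + ((e * (n * s - m * u) : ℤ) : ℝ) * (tau g).1,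
        ((e * (m * v - n * t) : ℤ) : ℝ) + ((e * (n * s - m * u) : ℤ) : ℝ) * (tau g).2),
        mem_fracIdeal.mpr ⟨_, _, rfl, rfl⟩, ?_⟩
      ext
      · rw [Prod.fst_mul, hm]; push_cast
        linear_combination ((s + u * (tau f).1) * (m * v - n * t + (n * s - m * u) * (tau g).1))
          * heR + ((n : ℝ) * s - m * u) * h1 + (m + n * (tau f).1) * hdet'
      · rw [Prod.snd_mul, hn]; push_cast
        linear_combination ((s + u * (tau f).2) * (m * v - n * t + (n * s - m * u) * (tau g).2))
          * heR + ((n : ℝ) * s - m * u) * h2 + (m + n * (tau f).2) * hdet'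
    · rintro ⟨w, hw, rfl⟩
      obtain ⟨m, n, hm, hn⟩ := mem_fracIdeal.mp hw
      refine ⟨e * (m * s + n * t), e * (m * u + n * v), ?_, ?_⟩
      · rw [Prod.fst_mul, hm]; push_cast
        linear_combination ((e : ℝ) * n) * h1
      · rw [Prod.snd_mul, hn]; push_cast
        linear_combination ((e : ℝ) * n) * h2
  · refine pos_of_mul_pos_left (b := (e : ℝ) * (s + u * (tau f).1)) ?_ hpos.le
    have : (e : ℝ) * (s + u * (tau f).2) * (f.a * g.a) * (e * (s + u * (tau f).1)) = g.a ^ 2 := by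
      linear_combination ((s + u * (tau f).2) * (f.a * g.a) * (s + u * (tau f).1)) * heR
        + (g.a : ℝ) * h3
    simp only [this]
    positivity

theorem eval_eq_tau (f : BQForm) (hD : 0 < f.disc) (ha : f.a ≠ 0) (x y : ℤ) :
    (f.eval x y : ℝ) = f.a * ((x + y * (tau f).1) * (x + y * (tau f).2)) := by
  have ha' : (f.a : ℝ) ≠ 0 := by exact_mod_cast ha
  have hs := sq_sqrt_disc hD
  simp only [eval, tau]
  push_cast
  field_simp
  linear_combination ((y : ℝ) ^ 2) * hs

/-- A similarity is given by an integral matrix, whose determinant is positive. -/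
theorem IdealRel.exists_matrix {f g : BQForm} {l : ℝ × ℝ} (H : IdealRel f g l)
    (hD : 0 < f.disc) (hd : g.disc = f.disc) (ha : f.a ≠ 0) (hg : g.a ≠ 0) :
    ∃ s t u v : ℤ, (l.1 = s + u * (tau f).1 ∧ l.2 = s + u * (tau f).2) ∧
      (l.1 * (tau g).1 = t + v * (tau f).1 ∧ l.2 * (tau g).2 = t + v * (tau f).2) ∧
      0 < s * v - t * u ∧ ((s * v - t * u : ℤ) : ℝ) * g.a = l.1 * l.2 * f.a := by
  have h1 : l ∈ fracIdeal f := by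
    rw [H.eq, mem_scalar_mul]
    exact ⟨1, mem_fracIdeal.mpr ⟨1, 0, by simp, by simp⟩, mul_one l⟩
  have h2 : l * tau g ∈ fracIdeal f := by
    rw [H.eq, mem_scalar_mul]
    exact ⟨tau g, mem_fracIdeal.mpr ⟨0, 1, by simp, by simp⟩, rfl⟩
  obtain ⟨s, u, hs, hu⟩ := mem_fracIdeal.mp h1
  obtain ⟨t, v, ht, hv⟩ := mem_fracIdeal.mp h2
  rw [Prod.fst_mul] at ht
  rw [Prod.snd_mul] at hv
  have ha' : (f.a : ℝ) ≠ 0 := by exact_mod_cast ha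
  have hg' : (g.a : ℝ) ≠ 0 := by exact_mod_cast hg
  have hw : 0 < √(f.disc : ℝ) := Real.sqrt_pos.mpr (by exact_mod_cast hD)
  have e1 : ((tau f).1 - (tau f).2) * f.a = √(f.disc : ℝ) := by
    simp only [tau]; field_simp; ring
  have e2 : ((tau g).1 - (tau g).2) * g.a = √(f.disc : ℝ) := by
    simp only [tau, hd]; field_simp; ring
  -- Comparison of oriented covolumes: the difference of the two conjugates of τ is √D/a for either
  -- form.
  have key : ((s * v - t * u : ℤ) : ℝ) * g.a = l.1 * l.2 * f.a := by
    apply mul_right_cancel₀ hw.ne'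
    have h3 : ((s * v - t * u : ℤ) : ℝ) * ((tau f).1 - (tau f).2)
        = l.1 * l.2 * ((tau g).1 - (tau g).2) := by
      have : l.1 * l.2 * ((tau g).1 - (tau g).2)
        = l.2 * (l.1 * (tau g).1) - l.1 * (l.2 * (tau g).2) := by ring
      rw [this, ht, hv, hs, hu]; push_cast; ring
    linear_combination ((g.a : ℝ) * f.a) * h3 - ((s * v - t * u : ℤ) : ℝ) * g.a * e1
      + l.1 * l.2 * f.a * e2
  refine ⟨s, t, u, v, ⟨hs, hu⟩, ⟨ht, hv⟩, ?_, key⟩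
  have h4 : 0 < l.1 * (l.2 * (f.a * g.a)) := mul_pos H.fst_pos H.sign
  have h5 : l.1 * (l.2 * (f.a * g.a)) = ((s * v - t * u : ℤ) : ℝ) * g.a ^ 2 := by
    linear_combination (-(g.a : ℝ)) * key
  rw [h5] at h4
  exact_mod_cast pos_of_mul_pos_left h4 (sq_nonneg _)

/-- The matrices of l and of l⁻¹ have positive integral determinants with product 1, so both are 1.
Since f(x, y) is `f.a` times the norm of x + yτ, the matrix carries one form to the other. -/
theorem IdealRel.properlyEquiv {f g : BQForm} {l : ℝ × ℝ} (H : IdealRel f g l)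
    (hD : 0 < f.disc) (hd : g.disc = f.disc) (ha : f.a ≠ 0) (hg : g.a ≠ 0) :
    f.ProperlyEquiv g := by
  obtain ⟨s, t, u, v, ⟨h1, h2⟩, ⟨h3, h4⟩, hpos, hdet⟩ := H.exists_matrix hD hd ha hg
  obtain ⟨s', t', u', v', -, -, hpos', hdet'⟩ :=
    H.symm.exists_matrix (by rwa [hd]) hd.symm hg ha
  have ha' : (f.a : ℝ) ≠ 0 := by exact_mod_cast ha
  have hg' : (g.a : ℝ) ≠ 0 := by exact_mod_cast hg
  have hl1 := H.fst_pos.ne'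
  have hl2 := H.snd_ne_zero
  have hprod : (s * v - t * u) * (s' * v' - t' * u') = 1 := by
    have : ((s * v - t * u : ℤ) : ℝ) * ((s' * v' - t' * u' : ℤ) : ℝ) = 1 := by
      apply mul_right_cancel₀ (mul_ne_zero ha' hg')
      simp only [Prod.fst_inv, Prod.snd_inv] at hdet'
      calc _ = (((s * v - t * u : ℤ) : ℝ) * g.a) * (((s' * v' - t' * u' : ℤ) : ℝ) * f.a) := by
            ring
        _ = _ := by rw [hdet, hdet']; field_simp
    exact_mod_cast this
  have hone : s * v - t * u = 1 := Int.eq_one_of_mul_eq_one_right hpos.le hprod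
  rw [hone] at hdet
  refine ⟨s, t, u, v, hone, fun x y => ?_⟩
  have : (g.eval x y : ℝ) = (f.eval (s * x + t * y) (u * x + v * y) : ℝ) := by
    rw [eval_eq_tau g (by rwa [hd]) hg, eval_eq_tau f hD ha]
    have hg'' : (g.a : ℝ) = l.1 * l.2 * f.a := by rw [← hdet]; simp
    have e1 : (((s * x + t * y : ℤ) : ℝ) + ((u * x + v * y : ℤ) : ℝ) * (tau f).1)
        = l.1 * (x + y * (tau g).1) := by
      push_cast; linear_combination (-(x : ℝ)) * h1 - (y : ℝ) * h3
    have e2 : (((s * x + t * y : ℤ) : ℝ) + ((u * x + v * y : ℤ) : ℝ) * (tau f).2)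
        = l.2 * (x + y * (tau g).2) := by
      push_cast; linear_combination (-(x : ℝ)) * h2 - (y : ℝ) * h4
    rw [e1, e2, hg'']; ring
  exact_mod_cast this

/-! ### Composition and products of lattices -/

theorem mem_fracIdeal_ring {f : BQForm} {z : ℝ × ℝ} :
    z ∈ fracIdeal f ↔ ∃ u v : ℤ, z = u + v * tau f := by
  simp only [mem_fracIdeal, Prod.ext_iff, Prod.fst_add, Prod.snd_add, Prod.fst_mul, Prod.snd_mul,
    Prod.fst_intCast, Prod.snd_intCast]

theorem mem_fracIdeal_mul (f g : BQForm) (k₀ k₁ k₂ k₃ : ℤ) :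
    (k₀ + k₁ * tau f + k₂ * tau g + k₃ * (tau f * tau g) : ℝ × ℝ) ∈ fracIdeal f * fracIdeal g := by
  have h : (k₀ + k₁ * tau f + k₂ * tau g + k₃ * (tau f * tau g) : ℝ × ℝ)
      = (k₀ + k₁ * tau f) * 1 + (k₂ + k₃ * tau f) * tau g := by ring
  rw [h]
  exact add_mem
    (mul_mem_mul (mem_fracIdeal_ring.mpr ⟨_, _, rfl⟩) (mem_fracIdeal_ring.mpr ⟨1, 0, by simp⟩))
    (mul_mem_mul (mem_fracIdeal_ring.mpr ⟨_, _, rfl⟩) (mem_fracIdeal_ring.mpr ⟨0, 1, by simp⟩))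

theorem exists_add_eq_two_mul {f g : BQForm} (h : g.disc = f.disc) :
    ∃ k : ℤ, f.b + g.b = 2 * k := by
  have h1 : Even (f.b ^ 2 - g.b ^ 2) :=
    ⟨2 * f.a * f.c - 2 * g.a * g.c, by simp only [disc] at h; linarith⟩
  rw [Int.even_sub, Int.even_pow, Int.even_pow] at h1
  have h2 : Even (f.b + g.b) := by rw [Int.even_add]; simpa using h1
  obtain ⟨k, hk⟩ := h2
  exact ⟨k, by rw [hk]; ring⟩

/-- The three congruences say exactly that n times τ_f, τ_g and τ_f τ_g lie in ℤ + ℤτ_k (relations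
R1, R2, R3 below, n being the cancelled factor). That is one inclusion. Conversely, Bézout for n
produces τ_k up to an integer, and primitivity of `f` produces 1. -/
theorem fracIdeal_mul {f g k : BQForm} (hD : 0 < f.disc) (hsq : ¬ IsSquare f.disc)
    (hg : g.disc = f.disc) (hk : k.disc = f.disc) (hf : f.IsPrimitive)
    (hka : k.a * (compFactor f g : ℤ) ^ 2 = f.a * g.a) (hc : CompCongr f g k.b) :
    fracIdeal f * fracIdeal g
      = scalar ((compFactor f g : ℝ)⁻¹, (compFactor f g : ℝ)⁻¹) * fracIdeal k := by
  have ha₁ := a_ne_zero hsq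
  have ha₂ : g.a ≠ 0 := a_ne_zero (by rwa [hg])
  obtain ⟨β, hβ⟩ := exists_add_eq_two_mul hg
  have hβ' : (f.b + g.b) / 2 = β := by omega
  have hprod : (f.b * g.b + f.disc) / 2 = f.b * β - 2 * f.a * f.c := by
    have : f.b * g.b + f.disc = 2 * (f.b * β - 2 * f.a * f.c) := by
      simp only [disc]; linear_combination f.b * hβ
    omega
  obtain ⟨c1, c2, c3⟩ := hc
  rw [hβ', hprod] at c3
  have hm₁ : (compFactor f g : ℤ) ∣ f.a := Int.gcd_dvd_left ..
  have hm' : (compFactor f g : ℤ) ∣ (Int.gcd g.a β : ℤ) := by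
    rw [← hβ']; exact Int.gcd_dvd_right ..
  have hm₂ : (compFactor f g : ℤ) ∣ g.a := hm'.trans (Int.gcd_dvd_left ..)
  have hm₃ : (compFactor f g : ℤ) ∣ β := hm'.trans (Int.gcd_dvd_right ..)
  obtain ⟨q, p, r, hbez⟩ : ∃ q p r : ℤ, (compFactor f g : ℤ) = q * f.a + p * g.a + r * β := by
    have h1 := Int.gcd_eq_gcd_ab f.a (Int.gcd g.a β : ℤ)
    have h2 := Int.gcd_eq_gcd_ab g.a β
    refine ⟨Int.gcdA f.a (Int.gcd g.a β : ℤ),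
      Int.gcdB f.a (Int.gcd g.a β : ℤ) * Int.gcdA g.a β,
      Int.gcdB f.a (Int.gcd g.a β : ℤ) * Int.gcdB g.a β, ?_⟩
    rw [compFactor, hβ']
    linear_combination h1 + Int.gcdB f.a (Int.gcd g.a β : ℤ) * h2
  obtain ⟨P, Q, R, hprim⟩ : ∃ P Q R : ℤ, P * f.a + Q * f.b + R * f.c = 1 := by
    have h1 := Int.gcd_eq_gcd_ab f.a (Int.gcd f.b f.c : ℤ)
    have h2 := Int.gcd_eq_gcd_ab f.b f.c
    have h3 : ((Int.gcd f.a (Int.gcd f.b f.c : ℤ) : ℕ) : ℤ) = 1 := by exact_mod_cast hf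
    refine ⟨Int.gcdA f.a (Int.gcd f.b f.c : ℤ),
      Int.gcdB f.a (Int.gcd f.b f.c : ℤ) * Int.gcdA f.b f.c,
      Int.gcdB f.a (Int.gcd f.b f.c : ℤ) * Int.gcdB f.b f.c, ?_⟩
    linear_combination h3 - h1 - Int.gcdB f.a (Int.gcd f.b f.c : ℤ) * h2
  generalize compFactor f g = n at *
  obtain ⟨α₁, hα₁⟩ := hm₁
  obtain ⟨α₂, hα₂⟩ := hm₂
  obtain ⟨β₁, hβ₁⟩ := hm₃
  have hn : (n : ℤ) ≠ 0 := by rintro h; rw [h, zero_mul] at hα₁; exact ha₁ hα₁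
  have hα₁0 : α₁ ≠ 0 := by rintro rfl; exact ha₁ (by rw [hα₁, mul_zero])
  have hα₂0 : α₂ ≠ 0 := by rintro rfl; exact ha₂ (by rw [hα₂, mul_zero])
  have hkα : k.a = α₁ * α₂ := by
    apply mul_right_cancel₀ (pow_ne_zero 2 hn)
    rw [hka, hα₁, hα₂]; ring
  have hbez1 : q * α₁ + p * α₂ + r * β₁ = 1 := by
    apply mul_left_cancel₀ hn
    linear_combination -hbez - q * hα₁ - p * hα₂ - r * hβ₁
  -- Cancelling n·a₂ leaves a congruence modulo 2a₁/n; the next two are treated likewise.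
  obtain ⟨x₁, hx₁⟩ : ∃ x, f.b - k.b = 2 * α₁ * x := by
    obtain ⟨x, hx⟩ := Int.modEq_iff_dvd.mp c1
    refine ⟨x, mul_left_cancel₀ (mul_ne_zero hn ha₂) ?_⟩
    linear_combination hx + 2 * g.a * x * hα₁
  obtain ⟨x₂, hx₂⟩ : ∃ x, g.b - k.b = 2 * α₂ * x := by
    obtain ⟨x, hx⟩ := Int.modEq_iff_dvd.mp c2
    refine ⟨x, mul_left_cancel₀ (mul_ne_zero hn ha₁) ?_⟩
    linear_combination hx + 2 * f.a * x * hα₂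
  obtain ⟨x₃, hx₃⟩ : ∃ x, f.b * β - 2 * f.a * f.c - β * k.b = 2 * n * α₁ * α₂ * x := by
    obtain ⟨x, hx⟩ := Int.modEq_iff_dvd.mp c3
    refine ⟨x, mul_left_cancel₀ hn ?_⟩
    rw [hα₁, hα₂] at hx
    rw [hα₁]
    linear_combination hx
  -- Eliminating τ_k from R1, R2, R3 leaves the integers nα₁, nβ₁, α₁x₁ - α₂x₂ and β₁x₁ - α₂x₃.
  -- These combine to the coefficients a, b, c of `f`, whose gcd is 1.
  have hdiff : f.b = n * β₁ + (α₁ * x₁ - α₂ * x₂) := by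
    linarith
  have hcc : β₁ * x₁ - α₂ * x₃ = f.c := by
    apply mul_left_cancel₀ (mul_ne_zero (mul_ne_zero two_ne_zero hn) hα₁0)
    rw [hα₁] at hx₃
    linear_combination (-β) * hx₁ + hx₃ - 2 * α₁ * x₁ * hβ₁
  -- the same relations between real numbers
  have hnR : (n : ℝ) ≠ 0 := by exact_mod_cast hn
  have hα₁R : (α₁ : ℝ) ≠ 0 := by exact_mod_cast hα₁0
  have hα₂R : (α₂ : ℝ) ≠ 0 := by exact_mod_cast hα₂0
  have hx₁R : (f.b : ℝ) - k.b = 2 * α₁ * x₁ := by exact_mod_cast hx₁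
  have hx₂R : (g.b : ℝ) - k.b = 2 * α₂ * x₂ := by exact_mod_cast hx₂
  have hx₃R : (f.b : ℝ) * β - 2 * f.a * f.c - β * k.b = 2 * n * α₁ * α₂ * x₃ := by
    exact_mod_cast hx₃
  have hβR : (f.b : ℝ) + g.b = 2 * β := by exact_mod_cast hβ
  have hβ₁R : (β : ℝ) = n * β₁ := by exact_mod_cast hβ₁
  have haR : (f.a : ℝ) = n * α₁ := by exact_mod_cast hα₁
  have hgaR : (g.a : ℝ) = n * α₂ := by exact_mod_cast hα₂
  have hkaR : (k.a : ℝ) = α₁ * α₂ := by exact_mod_cast hkα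
  have hs := sq_sqrt_disc hD
  have R1 : ((n : ℤ) : ℝ × ℝ) * tau f = α₂ * tau k + x₁ := by
    ext <;> simp only [tau, hk, Prod.fst_mul, Prod.snd_mul, Prod.fst_add, Prod.snd_add,
      Prod.fst_intCast, Prod.snd_intCast, hkaR, haR, Int.cast_natCast,
      Prod.fst_natCast, Prod.snd_natCast] <;> field_simp <;>
      linear_combination hx₁R
  have R2 : ((n : ℤ) : ℝ × ℝ) * tau g = α₁ * tau k + x₂ := by
    ext <;> simp only [tau, hg, hk, Prod.fst_mul, Prod.snd_mul, Prod.fst_add, Prod.snd_add,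
      Prod.fst_intCast, Prod.snd_intCast, hkaR, hgaR, Int.cast_natCast,
      Prod.fst_natCast, Prod.snd_natCast] <;> field_simp <;>
      linear_combination hx₂R
  have R3 : ((n : ℤ) : ℝ × ℝ) * (tau f * tau g) = β₁ * tau k + x₃ := by
    have hw : √(f.disc : ℝ) ^ 2 + f.b * g.b = 2 * (β * k.b + 2 * n * α₁ * α₂ * x₃) := by
      linear_combination hs + (f.b : ℝ) * hβR + 2 * hx₃R
    ext <;> simp only [tau, hg, hk, Prod.fst_mul, Prod.snd_mul, Prod.fst_add, Prod.snd_add,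
      Prod.fst_intCast, Prod.snd_intCast, hkaR, haR, hgaR, Int.cast_natCast,
      Prod.fst_natCast, Prod.snd_natCast] <;> field_simp
    · linear_combination hw + √(f.disc : ℝ) * hβR + 2 * (k.b + √(f.disc : ℝ)) * hβ₁R
    · linear_combination hw - √(f.disc : ℝ) * hβR + 2 * (k.b - √(f.disc : ℝ)) * hβ₁R
  have hinv : ((n : ℝ)⁻¹, (n : ℝ)⁻¹) * ((n : ℤ) : ℝ × ℝ) = 1 := by
    ext <;> simp [hnR]
  have cast_eq : ∀ {a b : ℤ}, a = b → ((a : ℤ) : ℝ × ℝ) = b := fun h => by rw [h]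
  apply le_antisymm
  · rw [mul_le]
    intro z hz z' hz'
    obtain ⟨u, v, rfl⟩ := mem_fracIdeal_ring.mp hz
    obtain ⟨u', v', rfl⟩ := mem_fracIdeal_ring.mp hz'
    rw [mem_scalar_mul]
    refine ⟨((u * u' * n + u * v' * x₂ + v * u' * x₁ + v * v' * x₃ : ℤ) : ℝ × ℝ)
      + ((u * v' * α₁ + v * u' * α₂ + v * v' * β₁ : ℤ) : ℝ × ℝ) * tau k,
      mem_fracIdeal_ring.mpr ⟨_, _, rfl⟩, ?_⟩
    have : (((u * u' * n + u * v' * x₂ + v * u' * x₁ + v * v' * x₃ : ℤ) : ℝ × ℝ)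
      + ((u * v' * α₁ + v * u' * α₂ + v * v' * β₁ : ℤ) : ℝ × ℝ) * tau k)
      = ((n : ℤ) : ℝ × ℝ) * ((u + v * tau f) * (u' + v' * tau g)) := by
      push_cast at R1 R2 R3 ⊢
      linear_combination (-(u : ℝ × ℝ) * v') * R2 - (v : ℝ × ℝ) * u' * R1
        - (v : ℝ × ℝ) * v' * R3
    rw [this, ← mul_assoc, hinv, one_mul]
  · intro z hz
    obtain ⟨w, hw, rfl⟩ := mem_scalar_mul.mp hz
    obtain ⟨u, v, rfl⟩ := mem_fracIdeal_ring.mp hw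
    -- The Bézout combination of R1, R2, R3 is τ_k + X. The integer u - vX that remains is supplied
    -- by the combination P a + Q b + R c = 1.
    set X := p * x₁ + q * x₂ + r * x₃ with hX
    have hmem := mem_fracIdeal_mul f g ((u - v * X) * (P * α₁ + Q * β₁))
      ((u - v * X) * (Q * α₁ + R * β₁) + v * p) (-((u - v * X) * (Q * α₂)) + v * q)
      (-((u - v * X) * (R * α₂)) + v * r)
    convert hmem using 1
    have hone : P * α₁ * n + Q * β₁ * n + Q * (α₁ * x₁ - α₂ * x₂) + R * (β₁ * x₁ - α₂ * x₃)
        = 1 := by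
      rw [hcc]; linear_combination hprim - P * hα₁ - Q * hdiff
    have hone' := cast_eq hone
    have hbez' := cast_eq hbez1
    have hX' := cast_eq hX
    push_cast at hone' hbez' hX' R1 R2 R3 hinv ⊢
    have key : (u + v * tau k : ℝ × ℝ) = n * (((u - v * X) * (P * α₁ + Q * β₁))
      + ((u - v * X) * (Q * α₁ + R * β₁) + v * p) * tau f
      + (-((u - v * X) * (Q * α₂)) + v * q) * tau g
      + (-((u - v * X) * (R * α₂)) + v * r) * (tau f * tau g)) := by
      linear_combination (-((u : ℝ × ℝ) - v * X)) * hone' - (v : ℝ × ℝ) * tau k * hbez'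
        + (v : ℝ × ℝ) * hX'
        - (((u : ℝ × ℝ) - v * X) * (Q * α₁ + R * β₁) + v * p) * R1
        - (-(((u : ℝ × ℝ) - v * X) * (Q * α₂)) + v * q) * R2
        - (-(((u : ℝ × ℝ) - v * X) * (R * α₂)) + v * r) * R3
    rw [key, ← mul_assoc, hinv, one_mul]

/-! ### The distance as a similarity factor -/

theorem IdealRel.pow {f : BQForm} {l : ℝ × ℝ} (ha : f.a ≠ 0) (H : IdealRel f f l) (n : ℕ) :
    IdealRel f f (l ^ n) := by
  induction n with
  | zero => rw [pow_zero]; exact IdealRel.refl ha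
  | succ n ih => rw [pow_succ]; exact ih.trans H

/-- Multiplication by `x + y √D` maps the lattice of a form of discriminant `D` into itself. -/
theorem mul_mem_fracIdeal {f : BQForm} (hD : 0 < f.disc) (ha : f.a ≠ 0) (x y : ℤ) {z : ℝ × ℝ}
    (hz : z ∈ fracIdeal f) :
    ((x + y * √(f.disc : ℝ), x - y * √(f.disc : ℝ)) : ℝ × ℝ) * z ∈ fracIdeal f := by
  have ha' : (f.a : ℝ) ≠ 0 := by exact_mod_cast ha
  have hs := sq_sqrt_disc hD
  obtain ⟨u, v, hu, hv⟩ := mem_fracIdeal.mp hz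
  refine mem_fracIdeal.mpr ⟨x * u - y * f.b * u - 2 * y * v * f.c,
    x * v + 2 * f.a * y * u + y * f.b * v, ?_, ?_⟩
  · rw [Prod.fst_mul, hu]; simp only [tau]; push_cast; field_simp
    linear_combination ((y : ℝ) * v) * hs
  · rw [Prod.snd_mul, hv]; simp only [tau]; push_cast; field_simp
    linear_combination ((y : ℝ) * v) * hs

/-- A nontrivial solution of x² - Dy² = 1 gives |x| - |y|√D in (0, 1). Its inverse is its conjugate,
and both preserve the lattice. -/
theorem exists_unit {f : BQForm} (hD : 0 < f.disc) (hsq : ¬ IsSquare f.disc) :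
    ∃ e : ℝ × ℝ, e.1 < 1 ∧ IdealRel f f e := by
  obtain ⟨x, y, hxy, hy⟩ := Pell.exists_of_not_isSquare hD hsq
  have ha := a_ne_zero hsq
  have ha' : (f.a : ℝ) ≠ 0 := by exact_mod_cast ha
  set w := √(f.disc : ℝ) with hw
  have hw0 : 0 < w := Real.sqrt_pos.mpr (by exact_mod_cast hD)
  have hw2 : w ^ 2 = f.disc := Real.sq_sqrt (by exact_mod_cast hD.le)
  have hn : |(x : ℝ)| ^ 2 - (|(y : ℝ)| * w) ^ 2 = 1 := by
    rw [mul_pow, sq_abs, sq_abs, hw2]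
    have : (x : ℝ) ^ 2 - f.disc * y ^ 2 = 1 := by exact_mod_cast hxy
    linarith
  have hy1 : 1 ≤ |(y : ℝ)| := by exact_mod_cast Int.one_le_abs hy
  have hyw : 0 < |(y : ℝ)| * w := mul_pos (by linarith) hw0
  have hfac : (|(x : ℝ)| - |(y : ℝ)| * w) * (|(x : ℝ)| + |(y : ℝ)| * w) = 1 := by
    linear_combination hn
  have hx0 : 1 ≤ |(x : ℝ)| := by nlinarith [abs_nonneg (x : ℝ)]
  have hp2 : 0 < |(x : ℝ)| + |(y : ℝ)| * w := by positivity
  have hp1 : 0 < |(x : ℝ)| - |(y : ℝ)| * w := by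
    by_contra! h
    nlinarith
  refine ⟨(|(x : ℝ)| - |(y : ℝ)| * w, |(x : ℝ)| + |(y : ℝ)| * w), ?_, ?_, hp1,
    mul_pos hp2 (mul_self_pos.mpr ha')⟩
  · show |(x : ℝ)| - |(y : ℝ)| * w < 1
    nlinarith
  · have h1 : ∀ z ∈ fracIdeal f,
        ((|(x : ℝ)| - |(y : ℝ)| * w, |(x : ℝ)| + |(y : ℝ)| * w) : ℝ × ℝ) * z ∈ fracIdeal f := by
      intro z hz
      have := mul_mem_fracIdeal hD ha |x| (-|y|) hz
      push_cast at this
      rwa [neg_mul, sub_neg_eq_add, ← sub_eq_add_neg] at this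
    have h2 : ∀ z ∈ fracIdeal f,
        ((|(x : ℝ)| + |(y : ℝ)| * w, |(x : ℝ)| - |(y : ℝ)| * w) : ℝ × ℝ) * z ∈ fracIdeal f := by
      intro z hz
      have := mul_mem_fracIdeal hD ha |x| |y| hz
      push_cast at this
      exact this
    ext z
    rw [mem_scalar_mul]
    constructor
    · intro hz
      refine ⟨_, h2 z hz, ?_⟩
      ext
      · simp only [Prod.fst_mul]; linear_combination z.1 * hfac
      · simp only [Prod.snd_mul]; linear_combination z.2 * hfac
    · rintro ⟨u, hu, rfl⟩
      exact h1 u hu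

/-- A power of a small unit brings the factor below 1, where `IdealRel.exists_iterate` applies.
Hence the infimum in `dist` is attained and is not the default value of `sInf ∅`. -/
theorem IdealRel.exists_isTerm {f g : BQForm} {l : ℝ × ℝ} (H : IdealRel f g l)
    (hf : f.IsReduced) (hg : g.IsReduced) (hD : 0 < f.disc) (hsq : ¬ IsSquare f.disc)
    (hgd : g.disc = f.disc) : ∃ n, IsTerm f g n := by
  obtain ⟨e, he1, he⟩ := exists_unit hD hsq
  obtain ⟨N, hN⟩ := exists_pow_lt_of_lt_one (inv_pos.mpr H.fst_pos) he1
  have h1 := (he.pow (a_ne_zero hsq) N).trans H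
  have hl : (e ^ N * l).1 ≤ 1 := by
    rw [Prod.fst_mul, Prod.pow_fst]
    calc e.1 ^ N * l.1 ≤ l.1⁻¹ * l.1 := by
          have := H.fst_pos; gcongr
      _ = 1 := inv_mul_cancel₀ H.fst_pos.ne'
  obtain ⟨n, hn, -⟩ := h1.exists_iterate hg (by rwa [hgd]) (by rwa [hgd]) hf hgd.symm hl
  exact ⟨n, (hf.isTerm_iff hD hsq hgd n).mpr hn⟩

theorem IdealRel.idealRel_dist {f g : BQForm} {l : ℝ × ℝ} (H : IdealRel f g l)
    (hf : f.IsReduced) (hg : g.IsReduced) (hD : 0 < f.disc) (hsq : ¬ IsSquare f.disc)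
    (hgd : g.disc = f.disc) : ∃ y, IdealRel f g (Real.exp (-dist f g), y) := by
  have hn : IsTerm f g (sInf {n | IsTerm f g n}) :=
    Nat.sInf_mem (H.exists_isTerm hf hg hD hsq hgd)
  rw [dist, hf.cycleLog_eq hD hsq, neg_neg, Real.exp_log (hf.contract_pos hD hsq _)]
  set n := sInf {n | IsTerm f g n}
  have hgn := (hf.isTerm_iff hD hsq hgd n).mp hn
  obtain ⟨y, hy⟩ := hf.idealRel_iterate hD hsq n
  exact ⟨y, by rwa [← hgn] at hy⟩

/-! ### The principal form and the regulator -/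

/-- The form `f` guarantees that D is a square modulo 4, which makes the division by 4 in
`principal` exact. -/
theorem principal_spec (f : BQForm) (hD : 0 < f.disc) (hsq : ¬ IsSquare f.disc) :
    (principal f.disc).a = 1 ∧ (principal f.disc).disc = f.disc ∧
      (principal f.disc).IsReduced ∧ ∃ k, (principal f.disc).b = f.b + 2 * k := by
  set w := √(f.disc : ℝ) with hw
  have hw2 : w ^ 2 = f.disc := Real.sq_sqrt (by exact_mod_cast hD.le)
  have hparD : Even (f.disc - f.b) := by
    have : f.disc - f.b = f.b * (f.b - 1) - 2 * (2 * f.a * f.c) := by simp only [disc]; ring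
    rw [this]
    exact (Int.even_mul_pred_self f.b).sub (even_two_mul _)
  -- D is 0 or 1 modulo 4, so the non-square D is neither 1 nor 4. Then √D > 2, which reducedness
  -- with a = 1 needs.
  have hD4 : 4 < f.disc := by
    obtain ⟨i, hi | hi⟩ := Int.even_or_odd' f.b
    · have h1 : f.disc = 4 * (i ^ 2 - f.a * f.c) := by simp only [disc, hi]; ring
      have h2 : i ^ 2 - f.a * f.c ≠ 1 := fun h => hsq ⟨2, by rw [h1, h]; norm_num⟩
      omega
    · have h1 : f.disc = 4 * (i ^ 2 + i - f.a * f.c) + 1 := by simp only [disc, hi]; ring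
      have h2 : i ^ 2 + i - f.a * f.c ≠ 0 := fun h => hsq ⟨1, by rw [h1, h]; norm_num⟩
      omega
  have hw0 : 2 < w := by
    rw [hw]
    refine Real.lt_sqrt_of_sq_lt ?_
    have : (4 : ℝ) < f.disc := by exact_mod_cast hD4
    linarith
  set P := principal f.disc with hP
  have hb : (P.b : ℝ) < w ∧ w < P.b + 2 ∧ Even (P.b - f.disc) := by
    have h1 : (⌊w⌋ : ℝ) < w := by
      refine lt_of_le_of_ne (Int.floor_le w) fun h => ?_
      have h2 : ((0 - ⌊w⌋ : ℤ) : ℝ) + ((1 : ℤ) : ℝ) * w = 0 := by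
        push_cast; rw [h]; ring
      exact one_ne_zero (eq_zero_of_add_mul_sqrt hD hsq h2).2
    have h2 : w < ⌊w⌋ + 1 := Int.lt_floor_add_one w
    have hPb : P.b = if Even (⌊w⌋ - f.disc) then ⌊w⌋ else ⌊w⌋ - 1 := rfl
    rw [hPb]
    split_ifs with h
    · exact ⟨h1, by linarith, h⟩
    · refine ⟨by push_cast; linarith, by push_cast; linarith, ?_⟩
      rw [Int.not_even_iff_odd] at h
      have := h.sub_odd odd_one
      rwa [sub_right_comm] at this
  obtain ⟨hb1, hb2, hb3⟩ := hb
  obtain ⟨k, hk⟩ : ∃ k, P.b = f.b + 2 * k := by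
    obtain ⟨k, hk⟩ := hb3.add hparD
    exact ⟨k, by linarith⟩
  have hdisc : P.disc = f.disc := by
    have hc : P.c = (P.b ^ 2 - f.disc) / 4 := rfl
    have h4 : P.b ^ 2 - f.disc = 4 * (f.b * k + k ^ 2 + f.a * f.c) := by
      rw [hk]; simp only [disc]; ring
    have ha : P.a = 1 := rfl
    have hc' : P.c = f.b * k + k ^ 2 + f.a * f.c := by
      rw [hc, h4]; exact Int.mul_ediv_cancel_left _ four_ne_zero
    rw [disc, ha, hc']
    linear_combination h4
  refine ⟨rfl, hdisc, ?_, k, hk⟩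
  have ha : (P.a : ℝ) = 1 := by exact_mod_cast (rfl : P.a = 1)
  rw [IsReduced, hdisc, ha, abs_one, abs_lt]
  exact ⟨⟨by linarith, by linarith⟩, hb1⟩

theorem contract_mul_of_isPeriodicPt {f : BQForm} {p : ℕ} (hp : next^[p] f = f) (k : ℕ) :
    contract f (p * k) = contract f p ^ k := by
  induction k with
  | zero => simp [contract_zero]
  | succ k ih => rw [mul_add, mul_one, add_comm, contract_add, hp, ih, pow_succ']

/-- Units of norm one are powers of the unit of the principal cycle. -/
theorem IdealRel.log_eq_regulator {D : ℤ} (hD : 0 < D) (hsq : ¬ IsSquare D)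
    (hPd : (principal D).disc = D) (hP : (principal D).IsReduced) {r : ℝ × ℝ}
    (H : IdealRel (principal D) (principal D) r) : ∃ z : ℤ, Real.log r.1 = z * regulator D := by
  have hPD : 0 < (principal D).disc := by rwa [hPd]
  have hPsq : ¬ IsSquare (principal D).disc := by rwa [hPd]
  wlog hr : r.1 ≤ 1 generalizing r
  · obtain ⟨z, hz⟩ := this H.symm (by
      rw [Prod.fst_inv]; exact inv_le_one_of_one_le₀ (not_le.mp hr).le)
    refine ⟨-z, ?_⟩
    rw [Prod.fst_inv, Real.log_inv] at hz
    push_cast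
    linarith
  rw [regulator, period]
  set P := principal D
  obtain ⟨n, hn, hrn⟩ := H.exists_iterate hP hPD hPsq hP rfl hr
  rcases Nat.eq_zero_or_pos n with h0 | h0
  · exact ⟨0, by rw [hrn, h0, contract_zero]; simp⟩
  have hterm := hP.isTerm_iff (g := P) hPD hPsq rfl
  have hmem := Nat.sInf_mem (s := {n | 0 < n ∧ IsTerm P P n}) ⟨n, h0, (hterm n).mpr hn⟩
  set p := sInf {n | 0 < n ∧ IsTerm P P n} with hp
  have hpp : BQForm.next^[p] P = P := ((hterm p).mp hmem.2).symm
  have hper : Function.IsPeriodicPt BQForm.next n P := hn.symm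
  -- The period is the minimal period under `next`, so it divides every return time n, and the
  -- factor of n steps is a power of the factor of one turn.
  have hmin : p = Function.minimalPeriod BQForm.next P := by
    refine le_antisymm (Nat.sInf_le ⟨hper.minimalPeriod_pos h0, (hterm _).mpr ?_⟩)
      (Function.IsPeriodicPt.minimalPeriod_le hmem.1 hpp)
    exact (Function.isPeriodicPt_minimalPeriod BQForm.next P).symm
  obtain ⟨k, hk⟩ : p ∣ n := hmin ▸ hper.minimalPeriod_dvd
  refine ⟨-k, ?_⟩
  rw [hrn, hk, contract_mul_of_isPeriodicPt hpp, Real.log_pow, hP.cycleLog_eq hPD hPsq]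
  push_cast
  ring

/-- The principal lattice is a ring: the principal form composed with itself gives itself, with
nothing cancelled. -/
theorem fracIdeal_principal_mul_self {f : BQForm} (hD : 0 < f.disc) (hsq : ¬ IsSquare f.disc) :
    fracIdeal (principal f.disc) * fracIdeal (principal f.disc)
      = fracIdeal (principal f.disc) := by
  obtain ⟨ha, hd, -⟩ := principal_spec f hD hsq
  set P := principal f.disc
  have hm : compFactor P P = 1 := by simp [compFactor, ha]
  have hc : P.b * P.b = P.disc + 4 * P.c := by simp only [disc, ha]; ring
  have h1 : (P.b + P.b) / 2 = P.b := by omega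
  have h2 : (P.b * P.b + P.disc) / 2 = P.b * P.b - 2 * P.c := by omega
  rw [fracIdeal_mul (k := P) (by rwa [hd]) (by rwa [hd]) rfl rfl (by simp [IsPrimitive, ha])
    (by simp [hm, ha])]
  · rw [hm, Nat.cast_one, inv_one]
    exact (congrArg (· * _) scalar_one).trans (one_mul _)
  · refine ⟨?_, ?_, ?_⟩
    · rw [hm, ha]; push_cast; ring_nf; rfl
    · rw [hm, ha]; push_cast; ring_nf; rfl
    · rw [hm, ha, h1, h2]
      refine Int.modEq_iff_dvd.mpr ⟨-P.c, by push_cast; ring⟩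

/-- The lattice of a primitive form is invertible. -/
theorem exists_fracIdeal_mul_eq {f : BQForm} (hD : 0 < f.disc) (hsq : ¬ IsSquare f.disc)
    (hf : f.IsPrimitive) : ∃ (S : Submodule ℤ (ℝ × ℝ)),
      fracIdeal f * S = fracIdeal (principal f.disc) := by
  obtain ⟨ha, hd, -, k, hk⟩ := principal_spec f hD hsq
  set P := principal f.disc
  -- The inverse class: composing with (a, -b, c) cancels |a| and leaves leading coefficient 1. The
  -- middle coefficient of the principal form solves the congruences because it has the parity of b.
  set g : BQForm := ⟨f.a, -f.b, f.c⟩ with hg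
  have hgd : g.disc = f.disc := by simp only [hg, disc]; ring
  have hm : compFactor f g = f.a.natAbs := by simp [compFactor, hg, Int.gcd_eq_natAbs_gcd_natAbs, Int.natAbs_abs]
  have ha0 : (f.a.natAbs : ℝ) ≠ 0 := by simpa using a_ne_zero hsq
  have h2 : (f.b * g.b + f.disc) / 2 = -2 * f.a * f.c := by
    have : f.b * g.b + f.disc = 2 * (-2 * f.a * f.c) := by simp only [hg, disc]; ring
    omega
  obtain ⟨e, he⟩ : ∃ e : ℤ, (f.a.natAbs : ℤ) = f.a * e := by
    rw [Int.natCast_natAbs]; exact (dvd_abs _ _).mpr dvd_rfl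
  have key := fracIdeal_mul (f := f) (g := g) (k := P) hD hsq hgd hd hf
    (by rw [hm, ha, Int.natCast_natAbs, sq_abs]; simp only [hg]; ring) (by
      rw [CompCongr, hm, h2, he, hk]
      simp only [hg]
      refine ⟨Int.modEq_iff_dvd.mpr ⟨-e * k, by ring⟩,
        Int.modEq_iff_dvd.mpr ⟨-e * (f.b + k), by ring⟩,
        Int.modEq_iff_dvd.mpr ⟨-e * f.c, by simp; ring⟩⟩)
  rw [hm] at key
  refine ⟨scalar ((f.a.natAbs : ℝ), (f.a.natAbs : ℝ)) * fracIdeal g, ?_⟩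
  rw [mul_left_comm, key, ← mul_assoc, ← scalar_mul, Prod.mk_mul_mk, mul_inv_cancel₀ ha0]
  exact (congrArg (· * _) scalar_one).trans (one_mul _)

/-- Multiplying the stabilized product by the inverses of both factors turns it into the principal
lattice, which `r` therefore fixes as well. -/
theorem idealRel_principal {f g : BQForm} (hD : 0 < f.disc) (hsq : ¬ IsSquare f.disc)
    (hgd : g.disc = f.disc) (hf : f.IsPrimitive) (hg : g.IsPrimitive) {r : ℝ × ℝ}
    (h : scalar r * (fracIdeal f * fracIdeal g) = fracIdeal f * fracIdeal g)
    (h1 : 0 < r.1) (h2 : 0 < r.2) :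
    IdealRel (principal f.disc) (principal f.disc) r := by
  obtain ⟨S, hS⟩ := exists_fracIdeal_mul_eq hD hsq hf
  obtain ⟨T, hT⟩ := exists_fracIdeal_mul_eq (f := g) (by rwa [hgd]) (by rwa [hgd]) hg
  rw [hgd] at hT
  obtain ⟨ha, -⟩ := principal_spec f hD hsq
  refine ⟨?_, h1, by rw [ha]; simpa using h2⟩
  have hST : fracIdeal f * fracIdeal g * (S * T) = fracIdeal (principal f.disc) := by
    rw [mul_mul_mul_comm, hS, hT, fracIdeal_principal_mul_self hD hsq]
  rw [← hST, ← mul_assoc (scalar r), h]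

/-! ### Composition followed by reduction -/

theorem compFactor_pos {f g : BQForm} (ha : f.a ≠ 0) : 0 < (compFactor f g : ℝ) := by
  have : compFactor f g ≠ 0 := by
    intro h0
    rw [compFactor, Int.gcd_eq_zero_iff] at h0
    exact ha h0.1
  exact_mod_cast Nat.pos_of_ne_zero this

theorem IsCompRed.fracIdeal_mul {f g h : BQForm} {δ : ℝ} (H : IsCompRed f g h δ)
    (hD : 0 < f.disc) (hsq : ¬ IsSquare f.disc) (hgd : g.disc = f.disc) (hf : f.IsPrimitive) :
    h.IsReduced ∧ h.disc = f.disc ∧ ∃ y : ℝ, 0 < y * (f.a * g.a * h.a) ∧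
      fracIdeal f * fracIdeal g
        = scalar (Real.exp (-δ) / compFactor f g, y) * fracIdeal h := by
  obtain ⟨k, θ, ⟨hka, hkd, hcc, -⟩, hred, rfl⟩ := H
  obtain ⟨⟨y, hy⟩, hh, hhd⟩ := hred.idealRel (by rwa [hkd]) (by rwa [hkd])
  refine ⟨hh, hhd.trans hkd, (compFactor f g : ℝ)⁻¹ * y, ?_, ?_⟩
  · have hm := compFactor_pos (g := g) (a_ne_zero hsq)
    have hkaR : (k.a : ℝ) * (compFactor f g : ℝ) ^ 2 = f.a * g.a := by exact_mod_cast hka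
    have : (compFactor f g : ℝ)⁻¹ * y * (f.a * g.a * h.a)
        = y * (k.a * h.a) * compFactor f g := by
      rw [← hkaR]; field_simp
    rw [this]
    exact mul_pos hy.sign hm
  · rw [BQForm.fracIdeal_mul hD hsq hgd hkd hf hka hcc, hy.eq, ← mul_assoc, ← scalar_mul,
      neg_neg, Real.exp_log hy.fst_pos, Prod.mk_mul_mk, div_eq_inv_mul]

end BQForm

/-! ### The distance formula -/

open BQForm in
theorem mainTheorem2 (D : ℤ) (hD : 0 < D) (hsq : ¬ IsSquare D)
    (F₁ Fₖ G₁ Gₗ : BQForm)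
    (hF₁D : F₁.disc = D) (hG₁D : G₁.disc = D)
    (hF₁p : F₁.IsPrimitive) (hG₁p : G₁.IsPrimitive)
    (hF₁ : F₁.IsReduced) (hFₖ : Fₖ.IsReduced) (hG₁ : G₁.IsReduced) (hGₗ : Gₗ.IsReduced)
    (hF : F₁.ProperlyEquiv Fₖ) (hG : G₁.ProperlyEquiv Gₗ)
    (H₁ H₂ : BQForm) (δ₁ δ₂ : ℝ)
    (h₁ : BQForm.IsCompRed F₁ G₁ H₁ δ₁) (h₂ : BQForm.IsCompRed Fₖ Gₗ H₂ δ₂) :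
    H₁.ProperlyEquiv H₂ ∧
    ∃ z : ℤ, BQForm.dist H₁ H₂ =
      BQForm.dist F₁ Fₖ + BQForm.dist G₁ Gₗ + δ₂ - δ₁
        + Real.log ((BQForm.compFactor Fₖ Gₗ : ℝ) / (BQForm.compFactor F₁ G₁ : ℝ))
        + z * BQForm.regulator D := by
  subst hF₁D
  have hG₁sq : ¬ IsSquare G₁.disc := by rwa [hG₁D]
  have hG₁0 : 0 < G₁.disc := by rwa [hG₁D]
  have hFₖD := hF.disc_eq
  have hGₗD : Gₗ.disc = F₁.disc := hG.disc_eq.trans hG₁D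
  have hFₖsq : ¬ IsSquare Fₖ.disc := by rwa [hFₖD]
  have hFₖ0 : 0 < Fₖ.disc := by rwa [hFₖD]
  obtain ⟨_, hF'⟩ := hF.exists_idealRel hD hsq
  obtain ⟨_, hG'⟩ := hG.exists_idealRel hG₁0 hG₁sq
  obtain ⟨y, hFr⟩ := hF'.idealRel_dist hF₁ hFₖ hD hsq hFₖD
  obtain ⟨y', hGr⟩ := hG'.idealRel_dist hG₁ hGₗ hG₁0 hG₁sq hG.disc_eq
  have hFₖp : Fₖ.IsPrimitive := hF.isPrimitive hF₁p
  obtain ⟨hH₁, hH₁D, y₁, hy₁, e₁⟩ := h₁.fracIdeal_mul hD hsq hG₁D hF₁p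
  obtain ⟨hH₂, hH₂D, y₂, hy₂, e₂⟩ := h₂.fracIdeal_mul hFₖ0 hFₖsq (hGₗD.trans hFₖD.symm) hFₖp
  rw [hFₖD] at hH₂D
  have hm₁ := compFactor_pos (g := G₁) (a_ne_zero hsq)
  have hm₂ := compFactor_pos (g := Gₗ) (a_ne_zero hFₖsq)
  set m₁ := (compFactor F₁ G₁ : ℝ)
  set m₂ := (compFactor Fₖ Gₗ : ℝ)
  set c₁ : ℝ × ℝ := (Real.exp (-δ₁) / m₁, y₁) with hc₁
  set c₂ : ℝ × ℝ := (Real.exp (-δ₂) / m₂, y₂) with hc₂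
  set pF : ℝ × ℝ := (Real.exp (-F₁.dist Fₖ), y)
  set pG : ℝ × ℝ := (Real.exp (-G₁.dist Gₗ), y')
  have hc₁1 : 0 < c₁.1 := div_pos (Real.exp_pos _) hm₁
  have hc₂1 : 0 < c₂.1 := div_pos (Real.exp_pos _) hm₂
  have hc₁2 : c₁.2 ≠ 0 := left_ne_zero_of_mul hy₁.ne'
  have hH₁sq : ¬ IsSquare H₁.disc := by rwa [hH₁D]
  have hH₁0 : 0 < H₁.disc := by rwa [hH₁D]
  have hH₂₁ : H₂.disc = H₁.disc := hH₂D.trans hH₁D.symm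
  have haH₁ := a_ne_zero hH₁sq
  have haH₂ : H₂.a ≠ 0 := a_ne_zero (by rwa [hH₂D])
  -- the lattices of the two outputs are similar
  have hrel : IdealRel H₁ H₂ (c₁⁻¹ * (pF * pG * c₂)) := by
    have hmul : scalar c₁ * fracIdeal H₁ = scalar (pF * pG * c₂) * fracIdeal H₂ := by
      rw [← e₁, hFr.eq, hGr.eq, mul_mul_mul_comm, e₂, scalar_mul, scalar_mul]
      simp only [mul_assoc]
    refine ⟨?_, ?_, ?_⟩
    · rw [scalar_mul, mul_assoc, ← hmul, ← mul_assoc, scalar_inv_mul hc₁1.ne' hc₁2, one_mul]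
    · exact mul_pos (inv_pos.mpr hc₁1) (mul_pos (mul_pos (Real.exp_pos _) (Real.exp_pos _)) hc₂1)
    -- The product of the four sign conditions is the required quantity times a square.
    · have h := mul_pos (mul_pos hy₁ hy₂) (mul_pos hFr.sign hGr.sign)
      have : y₁ * (F₁.a * G₁.a * H₁.a) * (y₂ * (Fₖ.a * Gₗ.a * H₂.a))
          * (pF.2 * (F₁.a * Fₖ.a) * (pG.2 * (G₁.a * Gₗ.a)))
          = (c₁⁻¹ * (pF * pG * c₂)).2 * (H₁.a * H₂.a)
            * (y₁ * (F₁.a * G₁.a * Fₖ.a * Gₗ.a)) ^ 2 := by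
        have : y₁ ≠ 0 := hc₁2
        simp only [Prod.snd_mul, Prod.snd_inv, hc₁, hc₂]
        field_simp
      rw [this] at h
      exact pos_of_mul_pos_left h (sq_nonneg _)
  refine ⟨hrel.properlyEquiv hH₁0 hH₂₁ haH₁ haH₂, ?_⟩
  obtain ⟨y₃, hdist⟩ := hrel.idealRel_dist hH₁ hH₂ hH₁0 hH₁sq hH₂₁
  -- Two similarities from H₁ to H₂ differ by a unit of the lattice of H₁; by `e₁` it also fixes the
  -- product of the lattices of F₁ and G₁.
  have hunit := hrel.trans hdist.symm
  set r := c₁⁻¹ * (pF * pG * c₂) * (Real.exp (-H₁.dist H₂), y₃)⁻¹ with hr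
  have hr2 : 0 < r.2 :=
    pos_of_mul_pos_left hunit.sign (mul_self_nonneg _)
  have hP : IdealRel (principal F₁.disc) (principal F₁.disc) r := by
    refine idealRel_principal hD hsq hG₁D hF₁p hG₁p ?_ hunit.fst_pos hr2
    rw [e₁, mul_left_comm, ← hunit.eq]
  obtain ⟨-, hPd, hPred, -⟩ := principal_spec F₁ hD hsq
  obtain ⟨z, hz⟩ := hP.log_eq_regulator hD hsq hPd hPred
  refine ⟨z, ?_⟩
  have hlog : Real.log r.1 = H₁.dist H₂ - F₁.dist Fₖ - G₁.dist Gₗ - δ₂ + δ₁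
      - Real.log (m₂ / m₁) := by
    have : r.1 = Real.exp (H₁.dist H₂ - F₁.dist Fₖ - G₁.dist Gₗ - δ₂ + δ₁) / (m₂ / m₁) := by
      simp only [hr, hc₁, hc₂, pF, pG, Prod.fst_mul, Prod.fst_inv]
      rw [show H₁.dist H₂ - F₁.dist Fₖ - G₁.dist Gₗ - δ₂ + δ₁
        = -(-δ₁) + (-F₁.dist Fₖ + -G₁.dist Gₗ + -δ₂) + -(-H₁.dist H₂) by ring]
      rw [Real.exp_add, Real.exp_add, Real.exp_add, Real.exp_add, Real.exp_neg (-δ₁),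
        Real.exp_neg (-H₁.dist H₂)]
      field_simp
    rw [this, Real.log_div (Real.exp_pos _).ne' (by positivity), Real.log_exp]
  rw [← hz, hlog]
  ring
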